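/- Let $F_2$ be the free group of rank $2$. The free factor complex $\mathcal{AF}_2$ is the graph whose vertices are the nontrivial proper free factors of $F_2$, two distinct vertices $x,y$ being joined by an edge if $F_2 = x * y$. Write $D_1(x)$ for the set of neighbours of $x$ in $\mathcal{AF}_2$. Two vertices $x, y$ are called $1$-conjugate if there is a basis $\{g,z\}$ of $F_2$ with $x=\langle g\rangle$ and $y=\langle z^{-1}gz\rangle$; this defines a second (symmetric, loopless) graph structure $C$ on the vertices of $\mathcal{AF}_2$. For $j\ge 0$ let $C_j(x)$ be the set of vertices $y$ such that $j$ is the least length of a reduced $C$-path from $x$ to $y$ (so $C_0(x)=\{x\}$). A path $(x_0,\dots,x_n)$ in $\mathcal{AF}_2$ is said to avoid $C_m(y)$ if $x_i\notin\bigcup_{0\le j\le m}C_j(y)$ for all $0<i<n$. For an edge $\{x,y\}$ of $\mathcal{AF}_2$ put $\mathrm{Ext}_0(x,y)=\{x,y\}$, and let $\mathrm{Ext}_{k+1}(x,y)$ consist of the vertices in $\mathrm{Ext}_k(x,y)$ together with all vertices adjacent in $\mathcal{AF}_2$ to both $u$ and $v$ for some edge $\{u,v\}$ of $\mathcal{AF}_2$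 with $u,v\in\mathrm{Ext}_k(x,y)$. Then for every $k\in\mathbb{N}$ there is $k'\in\mathbb{N}$, depending only on $k$, such that the following holds for every vertex $\langle b\rangle$ of $\mathcal{AF}_2$: if $x,y\in D_1(\langle b\rangle)$ and there is a path in $\mathcal{AF}_2$ from $x$ to $y$ of length at most $k$ avoiding $C_k(\langle b\rangle)$, then $y\in\mathrm{Ext}_{k'}(x,\langle b\rangle)$. -/

import Mathlib

/-- The free group of rank two. -/
abbrev F2 : Type := FreeGroup (Fin 2)

/-- `F2` is the (internal) free product of its subgroups `H` and `K`: the canonical homomorphism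
from the abstract free product `H * K` to `F2` is bijective. -/
def IsFreeProduct (H K : Subgroup F2) : Prop :=
  Function.Bijective (Monoid.Coprod.lift H.subtype K.subtype)

/-- `H` is a free factor of `F2`. -/
def IsFreeFactor (H : Subgroup F2) : Prop := ∃ K : Subgroup F2, IsFreeProduct H K

theorem IsFreeProduct.symm {H K : Subgroup F2} (h : IsFreeProduct H K) : IsFreeProduct K H := by
  have e : (Monoid.Coprod.lift K.subtype H.subtype) =
      (Monoid.Coprod.lift H.subtype K.subtype).comp (Monoid.Coprod.swap K H) := by
    ext <;> simp
  unfold IsFreeProduct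
  rw [e, MonoidHom.coe_comp]
  exact h.comp (MulEquiv.coprodComm K H).bijective

/-- The vertices of the free factor complex of rank two: the nontrivial proper free factors. -/
def FreeFactorVertex : Type := {H : Subgroup F2 // IsFreeFactor H ∧ H ≠ ⊥ ∧ H ≠ ⊤}

/-- The free factor complex of rank two, as a graph: two distinct nontrivial proper free factors
are joined by an edge if `F2` is their free product. -/
def AF2 : SimpleGraph FreeFactorVertex where
  Adj x y := x ≠ y ∧ IsFreeProduct x.1 y.1
  symm := ⟨fun _ _ h => ⟨h.1.symm, h.2.symm⟩⟩
  loopless := ⟨fun _ h => h.1 rfl⟩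

/-- `D_k(x)`: the vertices at distance exactly `k` from `x`. -/
def sphereD (k : ℕ) (x : FreeFactorVertex) : Set FreeFactorVertex :=
  {y | IsLeast {n : ℕ | ∃ p : AF2.Walk x y, p.length = n} k}

/-- The vertex set of the `k`-extension of the edge `{x, y}`. An edge of the `k`-extension is an
edge of `AF2` between two of its vertices; the `1`-extension of an edge adds the common
neighbours (the sticks) of its two endpoints. -/
def kExt : ℕ → FreeFactorVertex → FreeFactorVertex → Set FreeFactorVertex
  | 0, x, y => {x, y}
  | k + 1, x, y => kExt k x y ∪
      {z | ∃ u ∈ kExt k x y, ∃ v ∈ kExt k x y, AF2.Adj u v ∧ AF2.Adj z u ∧ AF2.Adj z v}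

/-- `{g, h}` is a basis of `F2`. -/
def IsBasisPair (g h : F2) : Prop := ∃ B : FreeGroupBasis (Fin 2) F2, B 0 = g ∧ B 1 = h

/-- `y` is a `1`-conjugate of `x`: there is a basis `{g, z}` of `F2` such that `x` is generated by
`g` and `y` is generated by `g ^ z = z⁻¹ * g * z`. -/
def OneConj (x y : FreeFactorVertex) : Prop :=
  ∃ g z : F2, IsBasisPair g z ∧ x.1 = Subgroup.zpowers g ∧ y.1 = Subgroup.zpowers (z⁻¹ * g * z)

theorem IsBasisPair.conj_inv {g z : F2} (h : IsBasisPair g z) :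
    IsBasisPair (z⁻¹ * g * z) z⁻¹ := by
  obtain ⟨B, rfl, rfl⟩ := h
  let f : F2 →* F2 := FreeGroup.lift ![FreeGroup.of 0, (FreeGroup.of 1)⁻¹]
  have hf : f.comp f = MonoidHom.id F2 := by
    ext i
    fin_cases i <;> simp [f]
  let e : F2 ≃* F2 := MonoidHom.toMulEquiv f f hf hf
  refine ⟨⟨(MulAut.conj (B 1)).trans (B.repr.trans e)⟩, ?_, ?_⟩
  · change (MulAut.conj (B 1)).symm (B.repr.symm (f (FreeGroup.of 0))) = _
    simp [f, MulAut.conj_symm_apply]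
    rfl
  · change (MulAut.conj (B 1)).symm (B.repr.symm (f (FreeGroup.of 1))) = _
    have h : B.repr.symm (FreeGroup.of 1) = B 1 := rfl
    simp [f, MulAut.conj_symm_apply, h]

theorem OneConj.symm {x y : FreeFactorVertex} (h : OneConj x y) : OneConj y x := by
  obtain ⟨g, z, hb, hx, hy⟩ := h
  refine ⟨_, _, hb.conj_inv, hy, ?_⟩
  rw [hx]
  congr 1
  group

theorem OneConj.irrefl (x : FreeFactorVertex) : ¬ OneConj x x := by
  rintro ⟨g, z, ⟨B, rfl, rfl⟩, hx, hy⟩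
  let φ : F2 →* Equiv.Perm (Fin 3) := B.lift ![Equiv.swap 0 1, Equiv.swap 1 2]
  have h0 : φ (B 0) = Equiv.swap 0 1 := by simp [φ]
  have h1 : φ (B 1) = Equiv.swap 1 2 := by simp [φ]
  have hm : (B 1)⁻¹ * B 0 * B 1 ∈ Subgroup.zpowers (B 0) := by
    rw [← hx, hy]
    exact Subgroup.mem_zpowers _
  obtain ⟨n, hn⟩ := Subgroup.mem_zpowers_iff.1 hm
  have h2 := congrArg φ hn
  simp only [map_zpow, map_mul, map_inv, h0, h1] at h2
  have h3 := congrArg (fun s : Equiv.Perm (Fin 3) => s 2) h2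
  have h4 : ((Equiv.swap (0 : Fin 3) 1) ^ n) 2 = 2 :=
    Equiv.Perm.zpow_apply_eq_self_of_apply_eq_self (by decide) n
  simp only [h4] at h3
  revert h3
  decide

/-- The graph of `1`-conjugates on the vertices of `AF2`. -/
def conjGraph : SimpleGraph FreeFactorVertex where
  Adj := OneConj
  symm := ⟨fun _ _ h => h.symm⟩
  loopless := ⟨OneConj.irrefl⟩

/-- `C_k(x)`: the `y` for which `k` is the least length of a reduced path of `1`-conjugates
between `x` and `y`. In particular `C_0(x) = {x}`. -/
def conjSphere (k : ℕ) (x : FreeFactorVertex) : Set FreeFactorVertex :=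
  {y | IsLeast {n : ℕ | ∃ p : conjGraph.Walk x y, p.IsPath ∧ p.length = n} k}

/-- The path `p` avoids `C_m(b)`: no interior vertex of `p` is in `C_j(b)` for any `j ≤ m`. -/
def AvoidsConj {x y : FreeFactorVertex} (p : AF2.Walk x y) (m : ℕ) (b : FreeFactorVertex) :
    Prop :=
  ∀ i : ℕ, 0 < i → i < p.length → p.getVert i ∉ ⋃ j ≤ m, conjSphere j b

/-! After an automorphism, the given vertex is `⟨b⟩` and `x = ⟨a⟩` for the standard basis `a, b`.
Let `F2` act on the Bass-Serre tree of the HNN extension `⟨b⟩ *_1` with stable letter `a`: vertices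
are the cosets `g⟨b⟩`, and directions at the base vertex are the syllables `b ^ r * a ^ (±1)`. A
primitive element, inverted if necessary so that its `a`-exponent is nonnegative, either is
conjugate to `b ^ (±1)` and fixes a vertex, or has an axis. The axis (or fixed point) of `q`
contains `g⟨b⟩` exactly when `g⁻¹ * q * g` has no letter `a⁻¹`, that is, lies in `aPos`.

The neighbours of `⟨b⟩` are the groups `⟨b ^ i * a * b ^ j⟩`, whose axes leave the base vertex in
the directions `b ^ i * a` and `b ^ (-j) * a⁻¹`. Changing `i` or `j` by one costs one extension step
(`mem_kExt`), so it suffices to bound how far these directions move along the path.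

Nielsen's theorem in rank two (`Generate.isStandard`) supplies two facts: the axes of adjacent
vertices share a tree vertex, and at every vertex of the axis of a primitive element the turn (the
difference of the two `b`-exponents) is `N` or `N + 1` for a fixed `N`.

The bound `4 ^ n` in `abs_sub_le_four_pow` is proved by induction on the length `n`. If an interior
axis passes through the base vertex, cut the path there; avoidance guarantees that the interior
element is not `b ^ (±1)`. Otherwise the interior axes form a connected set missing the base vertex,
so the two end axes share a direction. At the next vertex in that direction, either the path can be
cut or the end axes share the onward direction too. The almost constant turn brings this estimate
back to the base vertex. Each move of the base vertex uses up one unit of the avoided radius. -/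

namespace FreeGroup

/-! ### Word length and cancellation in free groups. -/

variable {α : Type*} [DecidableEq α]

/-- The length of the longest common prefix of two lists. -/
def lcpLength {β : Type*} [DecidableEq β] : List β → List β → ℕ
  | x :: l, y :: m => if x = y then lcpLength l m + 1 else 0
  | _, _ => 0

theorem lcpLength_ultra {β : Type*} [DecidableEq β] (l m n : List β) :
    min (lcpLength l m) (lcpLength m n) ≤ lcpLength l n := by
  induction l generalizing m n with
  | nil => simp [lcpLength]
  | cons x l ih =>
    cases m with
    | nil => simp [lcpLength]
    | cons y m =>
      cases n with
      | nil => simp [lcpLength]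
      | cons z n =>
        have := ih m n
        simp only [lcpLength]
        split_ifs <;> grind

theorem isReduced_invRev_append {x y : α × Bool} {l m : List (α × Bool)}
    (hl : IsReduced (x :: l)) (hm : IsReduced (y :: m)) (h : x ≠ y) :
    IsReduced (invRev (x :: l) ++ y :: m) := by
  have h1 : IsReduced (invRev (x :: l)) := by
    rw [isReduced_iff_reduce_eq] at hl ⊢
    rw [reduce_invRev, hl]
  have h2 : invRev (x :: l) = invRev l ++ [(x.1, !x.2)] := by simp [invRev]
  have h3 : IsReduced ([(x.1, !x.2)] ++ y :: m) := by
    simp only [List.cons_append, List.nil_append]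
    refine List.isChain_cons_cons.2 ⟨fun h' => ?_, hm⟩
    by_contra h4
    refine h (Prod.ext h' ?_)
    simp only at h4
    revert h4
    cases x.2 <;> cases y.2 <;> simp
  rw [h2] at h1 ⊢
  exact h1.append_overlap h3 (by simp)

/-- The common prefix is exactly what cancels, so its length plays the role of a Gromov product. -/
theorem norm_inv_mul_mk {l m : List (α × Bool)} (hl : IsReduced l) (hm : IsReduced m) :
    norm ((mk l)⁻¹ * mk m) + 2 * lcpLength l m = l.length + m.length := by
  induction l generalizing m with
  | nil =>
    have : (mk ([] : List (α × Bool))) = 1 := rfl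
    simp [this, lcpLength, norm, hm.reduce_eq]
  | cons x l ih =>
    cases m with
    | nil =>
      have : (mk ([] : List (α × Bool))) = 1 := rfl
      rw [this, mul_one, norm_inv_eq, norm, toWord_mk, hl.reduce_eq]
      simp [lcpLength]
    | cons y m =>
      by_cases h : x = y
      · subst h
        have e : (mk (x :: l))⁻¹ * mk (x :: m) = (mk l)⁻¹ * mk m := by
          have (k : List (α × Bool)) : mk (x :: k) = mk [x] * mk k := by rw [mul_mk]; rfl
          rw [this l, this m]
          group
        have := ih (m := m) (List.IsChain.tail hl) (List.IsChain.tail hm)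
        rw [e]
        simp only [lcpLength, if_true, List.length_cons]
        omega
      · rw [inv_mk, mul_mk, norm, toWord_mk, (isReduced_invRev_append hl hm h).reduce_eq]
        simp [lcpLength, h, invRev_length]

/-- The length of the longest common prefix of the reduced words of two elements. -/
def gromov (g h : FreeGroup α) : ℕ := lcpLength g.toWord h.toWord

theorem norm_inv_mul (g h : FreeGroup α) :
    norm (g⁻¹ * h) + 2 * gromov g h = norm g + norm h := by
  have := norm_inv_mul_mk (isReduced_toWord (x := g)) (isReduced_toWord (x := h))
  rwa [mk_toWord, mk_toWord] at this

theorem norm_mul (g h : FreeGroup α) : norm (g * h) + 2 * gromov g⁻¹ h = norm g + norm h := by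
  have := norm_inv_mul g⁻¹ h
  rwa [inv_inv, norm_inv_eq] at this

theorem gromov_ultra (g h k : FreeGroup α) : min (gromov g h) (gromov h k) ≤ gromov g k :=
  lcpLength_ultra _ _ _

theorem gromov_comm (g h : FreeGroup α) : gromov g h = gromov h g := by
  have h1 := norm_inv_mul g h
  have h2 := norm_inv_mul h g
  have : norm (g⁻¹ * h) = norm (h⁻¹ * g) := by
    rw [← norm_inv_eq]
    congr 1
    group
  omega

/-- Write `x = c * r * c⁻¹` with `r` cyclically reduced and nonempty; squaring lengthens only the
core, since `x * x = c * r * r * c⁻¹` is still reduced. -/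
theorem norm_lt_norm_mul_self {x : FreeGroup α} (hx : x ≠ 1) : norm x < norm (x * x) := by
  have h2 := reduceCyclically.reduce_flatten_replicate_succ (isReduced_toWord (x := x)) 1
  have h1 := reduceCyclically.conj_conjugator_reduceCyclically x.toWord
  have h3 : reduceCyclically x.toWord ≠ [] := by
    intro h
    rw [h] at h1
    apply hx
    have := congrArg mk h1
    rw [mk_toWord, List.append_nil, ← mul_mk, ← inv_mk, mul_inv_cancel] at this
    exact this.symm
  have h4 := List.length_pos_iff.2 h3
  have h5 := congrArg List.length h1
  have h6 := congrArg List.length h2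
  have h7 : norm (x * x) = (reduce (List.replicate (1 + 1) x.toWord).flatten).length := by
    rw [← pow_two, norm, toWord_pow]
  simp only [List.length_append, invRev_length, List.length_flatten, List.map_replicate,
    List.sum_replicate, smul_eq_mul] at h5 h6
  rw [h7, h6, norm]
  omega

theorem exists_prefix (x : FreeGroup α) {k : ℕ} (hk : k ≤ norm x) :
    ∃ p : FreeGroup α, norm p = k ∧ gromov p x = k := by
  refine ⟨mk (x.toWord.take k), ?_⟩
  have h1 : IsReduced (x.toWord.take k) :=
    (isReduced_toWord (x := x)).infix (List.take_prefix _ _).isInfix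
  have h2 : (mk (x.toWord.take k)).toWord = x.toWord.take k := by rw [toWord_mk, h1.reduce_eq]
  have h3 : ∀ (l : List (α × Bool)) (k : ℕ), k ≤ l.length → lcpLength (l.take k) l = k := by
    intro l
    induction l with
    | nil => intro k hk; simp at hk; simp [lcpLength, hk]
    | cons y l ih =>
      intro k hk
      cases k with
      | zero => simp [lcpLength]
      | succ k => simp [lcpLength, ih k (by simpa using hk)]
  refine ⟨?_, ?_⟩
  · rw [norm, h2, List.length_take]
    exact min_eq_left hk
  · rw [gromov, h2, h3 _ _ hk]

end FreeGroup

open FreeGroup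

/-! ### Directions at the base vertex of the Bass-Serre tree. -/

/-- The first generator of `F2`. -/
abbrev ga : F2 := of 0

/-- The second generator of `F2`. -/
abbrev gb : F2 := of 1

/-- `a` if the sign is `true`, and `a⁻¹` otherwise. -/
def aPow (e : Bool) : F2 := if e then ga else ga⁻¹

@[simp] theorem aPow_true : aPow true = ga := rfl
@[simp] theorem aPow_false : aPow false = ga⁻¹ := rfl

@[simp] theorem aPow_not (e : Bool) : aPow (!e) = (aPow e)⁻¹ := by cases e <;> simp

/-- The first syllable `b ^ r * a ^ e` of a word, given as the pair `(r, e)`. -/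
def wordDir : List (Fin 2 × Bool) → Option (ℤ × Bool)
  | [] => none
  | (0, e) :: _ => some (0, e)
  | (1, e) :: l => (wordDir l).map fun d => (d.1 + (if e then 1 else -1), d.2)

/-- The first syllable `b ^ r * a ^ e` of the reduced word of an element of `F2`, given as the pair
`(r, e)`. It is the direction, at the base vertex of the Bass-Serre tree of the splitting
`⟨b⟩ *_1`, of the vertex `g⟨b⟩`. -/
def dir (g : F2) : Option (ℤ × Bool) := wordDir g.toWord

@[simp] theorem dir_one : dir 1 = none := by simp [dir, wordDir]

theorem toWord_mk_singleton_mul (x : Fin 2 × Bool) (g : F2) :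
    (mk [x] * g).toWord = x :: g.toWord ∨ g.toWord = (x.1, !x.2) :: (mk [x] * g).toWord := by
  rw [toWord_mul, toWord_mk, reduce_singleton]
  simp only [List.cons_append, List.nil_append, reduce.cons, reduce_toWord]
  cases h : g.toWord with
  | nil => simp
  | cons y l =>
    simp only
    split_ifs with h1
    · right
      rw [h1.1, h1.2]
      simp
    · left
      rfl

theorem dir_mk_one_mul (e : Bool) (g : F2) :
    dir (mk [(1, e)] * g) = (dir g).map fun d => (d.1 + (if e then 1 else -1), d.2) := by
  rcases toWord_mk_singleton_mul (1, e) g with h | h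
  · rw [dir, h, dir, wordDir]
  · simp only at h
    rw [dir, dir, h, wordDir]
    cases wordDir (mk [(1, e)] * g).toWord with
    | none => rfl
    | some d => cases e <;> simp

theorem dir_zpow_mul (r : ℤ) (g : F2) :
    dir (gb ^ r * g) = (dir g).map fun d => (d.1 + r, d.2) := by
  have h1 (g : F2) : dir (gb * g) = (dir g).map fun d => (d.1 + 1, d.2) := by
    exact (dir_mk_one_mul true g).trans (by simp)
  have h2 (g : F2) : dir (gb⁻¹ * g) = (dir g).map fun d => (d.1 - 1, d.2) := by
    exact (dir_mk_one_mul false g).trans (by simp [sub_eq_add_neg])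
  induction r with
  | zero => simp
  | succ n ih =>
    rw [add_comm, zpow_add, zpow_one, mul_assoc, h1, ih, Option.map_map]
    congr 1
    ext d <;> simp
    ring
  | pred n ih =>
    rw [sub_eq_add_neg, add_comm, zpow_add, zpow_neg_one, mul_assoc, h2, ih, Option.map_map]
    congr 1
    ext d <;> simp
    ring

/-- The excluded direction is the only one in which the new letter would cancel. -/
theorem dir_aPow_mul {e : Bool} {g : F2} (h : dir g ≠ some (0, !e)) :
    dir (aPow e * g) = some (0, e) := by
  have h0 : aPow e = mk [(0, e)] := by cases e <;> rfl
  rw [h0]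
  rcases toWord_mk_singleton_mul (0, e) g with h1 | h1
  · rw [dir, h1, wordDir]
  · simp only at h1
    rw [dir, h1, wordDir] at h
    exact absurd rfl h

/-- The element `b ^ r * a ^ e`. -/
def syl (r : ℤ) (e : Bool) : F2 := gb ^ r * aPow e

theorem dir_syl_mul {r : ℤ} {e : Bool} {g : F2} (h : dir g ≠ some (0, !e)) :
    dir (syl r e * g) = some (r, e) := by
  rw [syl, mul_assoc, dir_zpow_mul, dir_aPow_mul h]
  simp

@[simp] theorem dir_zpow (r : ℤ) : dir (gb ^ r) = none := by
  have := dir_zpow_mul r 1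
  simpa using this

theorem dir_eq_none {g : F2} (h : dir g = none) : ∃ r : ℤ, g = gb ^ r := by
  have key : ∀ l : List (Fin 2 × Bool), wordDir l = none → ∃ r : ℤ, mk l = gb ^ r := by
    intro l
    induction l with
    | nil => intro _; exact ⟨0, rfl⟩
    | cons x l ih =>
      obtain ⟨i, e⟩ := x
      intro hl
      have hm : mk ((i, e) :: l) = mk [(i, e)] * mk l := by rw [mul_mk]; rfl
      match i with
      | 0 => simp [wordDir] at hl
      | 1 =>
        simp only [wordDir, Option.map_eq_none_iff] at hl
        obtain ⟨r, hr⟩ := ih hl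
        rw [hm, hr]
        cases e
        · exact ⟨-1 + r, by rw [zpow_add, zpow_neg_one]; rfl⟩
        · exact ⟨1 + r, by rw [zpow_add, zpow_one]; rfl⟩
  simpa [mk_toWord] using key _ h

theorem exists_eq_syl_mul {g : F2} {r : ℤ} {e : Bool} (h : dir g = some (r, e)) :
    ∃ g', g = syl r e * g' ∧ norm g' < norm g := by
  have key : ∀ (l : List (Fin 2 × Bool)) (r : ℤ), wordDir l = some (r, e) →
      ∃ m, mk l = syl r e * mk m ∧ m.length < l.length := by
    intro l
    induction l with
    | nil => intro r hr; simp [wordDir] at hr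
    | cons x l ih =>
      obtain ⟨i, δ⟩ := x
      intro r hl
      have hm : mk ((i, δ) :: l) = mk [(i, δ)] * mk l := by rw [mul_mk]; rfl
      match i with
      | 0 =>
        simp only [wordDir, Option.some.injEq, Prod.mk.injEq] at hl
        obtain ⟨rfl, rfl⟩ := hl
        refine ⟨l, ?_, by simp⟩
        rw [hm, syl]
        cases δ <;> simp <;> rfl
      | 1 =>
        simp only [wordDir, Option.map_eq_some_iff, Prod.mk.injEq] at hl
        obtain ⟨⟨r', e'⟩, h1, rfl, rfl⟩ := hl
        obtain ⟨m, h2, h3⟩ := ih _ h1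
        refine ⟨m, ?_, by simp; omega⟩
        rw [hm, h2, ← mul_assoc]
        congr 1
        rw [syl, syl, add_comm, zpow_add, ← mul_assoc]
        cases δ <;> simp <;> rfl
  obtain ⟨m, h1, h2⟩ := key _ _ h
  refine ⟨mk m, ?_, lt_of_le_of_lt norm_mk_le h2⟩
  rw [← h1, mk_toWord]

theorem dir_ne_of_dir_syl_mul {r : ℤ} {e : Bool} {g : F2}
    (h : dir (syl r e * g) = some (r, e)) : dir g ≠ some (0, !e) := by
  intro h1
  obtain ⟨k, rfl, h2⟩ := exists_eq_syl_mul h1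
  have h3 : syl r e * (syl 0 (!e) * k) = gb ^ r * k := by simp [syl]
  rw [h3, dir_zpow_mul] at h
  simp only [Option.map_eq_some_iff, Prod.mk.injEq] at h
  obtain ⟨⟨s, e'⟩, h4, h5, rfl⟩ := h
  simp only [add_eq_right] at h5
  subst h5
  obtain ⟨m, rfl, h5⟩ := exists_eq_syl_mul h4
  have h6 : syl 0 (!e') * (syl 0 e' * m) = m := by simp [syl]
  rw [h6] at h2
  omega

/-- If the geodesic from the base vertex to `g` can be prolonged through `h`, the first direction
does not change. -/
theorem dir_mul {g h : F2} (hg : dir g ≠ none) (hgh : dir g⁻¹ ≠ dir h) :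
    dir (g * h) = dir g := by
  induction hn : norm g using Nat.strong_induction_on generalizing g h with
  | _ n ih =>
    obtain ⟨⟨r, e⟩, hd⟩ := Option.ne_none_iff_exists'.1 hg
    obtain ⟨g', rfl, hlt⟩ := exists_eq_syl_mul hd
    have hg' := dir_ne_of_dir_syl_mul hd
    have hinv : (syl r e * g')⁻¹ = g'⁻¹ * (aPow (!e) * gb ^ (-r)) := by
      simp [syl, mul_assoc]
    have ha : dir (aPow (!e) * gb ^ (-r)) = some (0, !e) := dir_aPow_mul (by rw [dir_zpow]; simp)
    rw [hd, mul_assoc]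
    apply dir_syl_mul
    rw [hinv] at hgh
    cases hn' : dir g' with
    | none =>
      obtain ⟨j, rfl⟩ := dir_eq_none hn'
      rw [← zpow_neg, dir_zpow_mul, ha] at hgh
      rw [dir_zpow_mul]
      intro h1
      simp only [Option.map_eq_some_iff, Prod.mk.injEq] at h1
      obtain ⟨⟨s, e'⟩, h4, h5, rfl⟩ := h1
      apply hgh
      rw [h4]
      simp only [Option.map_some, Option.some.injEq, Prod.mk.injEq, and_true]
      simp only at h5
      omega
    | some d =>
      have h3 : dir g'⁻¹ ≠ none := by
        intro h
        obtain ⟨j, hj⟩ := dir_eq_none h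
        rw [inv_eq_iff_eq_inv] at hj
        rw [hj, ← zpow_neg, dir_zpow] at hn'
        simp at hn'
      rw [ih _ (by rw [norm_inv_eq, ← hn]; exact hlt) h3 (by rwa [inv_inv, ha]) rfl] at hgh
      rw [ih _ (by rw [← hn]; exact hlt) (by simp [hn']) hgh rfl]
      exact hg'

theorem dir_inv_ne_none {g : F2} (h : dir g ≠ none) : dir g⁻¹ ≠ none := by
  intro h1
  obtain ⟨j, hj⟩ := dir_eq_none h1
  rw [inv_eq_iff_eq_inv] at hj
  rw [hj, ← zpow_neg, dir_zpow] at h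
  exact h rfl

theorem dir_mul_zpow (g : F2) (j : ℤ) : dir (g * gb ^ j) = dir g := by
  by_cases h : dir g = none
  · obtain ⟨r, rfl⟩ := dir_eq_none h
    rw [← zpow_add, dir_zpow, dir_zpow]
  · exact dir_mul h (by rw [dir_zpow]; exact dir_inv_ne_none h)

/-! ### Positive elements and their axes. -/

/-- The exponent sum of the first generator. -/
def expAHom : F2 →* Multiplicative ℤ := FreeGroup.lift ![Multiplicative.ofAdd 1, 1]

/-- The exponent sum of the first generator. -/
def expA (g : F2) : ℤ := (expAHom g).toAdd

@[simp] theorem expA_mul (g h : F2) : expA (g * h) = expA g + expA h := by simp [expA]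
@[simp] theorem expA_inv (g : F2) : expA g⁻¹ = -expA g := by simp [expA]
@[simp] theorem expA_one : expA 1 = 0 := by simp [expA]
@[simp] theorem expA_ga : expA ga = 1 := by simp [expA, expAHom]
@[simp] theorem expA_gb : expA gb = 0 := by simp [expA, expAHom]
@[simp] theorem expA_zpow (g : F2) (j : ℤ) : expA (g ^ j) = j * expA g := by simp [expA]

/-- `g` or its inverse, according to a sign. -/
def signed (g : F2) (e : Bool) : F2 := if e then g else g⁻¹

@[simp] theorem signed_true (g : F2) : signed g true = g := rfl
@[simp] theorem signed_false (g : F2) : signed g false = g⁻¹ := rfl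

/-- The submonoid of elements whose reduced words contain no `a⁻¹`. -/
def aPos : Submonoid F2 := Submonoid.closure {ga, gb, gb⁻¹}

theorem ga_mem_aPos : ga ∈ aPos := Submonoid.subset_closure (by simp)

theorem zpow_mem_aPos (j : ℤ) : gb ^ j ∈ aPos := by
  have h1 : gb ∈ aPos := Submonoid.subset_closure (by simp)
  have h2 : gb⁻¹ ∈ aPos := Submonoid.subset_closure (by simp)
  cases j with
  | ofNat n => simpa using pow_mem h1 n
  | negSucc n =>
    rw [zpow_negSucc, ← inv_pow]
    exact pow_mem h2 _

theorem aPos_left {p : F2} (hp : p ∈ aPos) :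
    (∃ j : ℤ, p = gb ^ j) ∨ ∃ r : ℤ, ∃ p' ∈ aPos, p = syl r true * p' := by
  have hb (j : ℤ) {y : F2} (ih : (∃ j : ℤ, y = gb ^ j) ∨ ∃ r : ℤ, ∃ p' ∈ aPos,
      y = syl r true * p') : (∃ k : ℤ, gb ^ j * y = gb ^ k) ∨ ∃ r : ℤ, ∃ p' ∈ aPos,
      gb ^ j * y = syl r true * p' := by
    rcases ih with ⟨k, rfl⟩ | ⟨r, p', h, rfl⟩
    · exact .inl ⟨j + k, (zpow_add _ _ _).symm⟩
    · exact .inr ⟨j + r, p', h, by simp [syl, zpow_add, mul_assoc]⟩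
  induction hp using Submonoid.closure_induction_left with
  | one => exact .inl ⟨0, rfl⟩
  | mul_left x hx y hy ih =>
    rcases hx with rfl | rfl | rfl
    · exact .inr ⟨0, y, hy, by simp [syl]⟩
    · simpa using hb 1 ih
    · simpa using hb (-1) ih

theorem aPos_right {p : F2} (hp : p ∈ aPos) :
    (∃ j : ℤ, p = gb ^ j) ∨ ∃ r : ℤ, ∃ p' ∈ aPos, p = p' * (syl r false)⁻¹ := by
  have hb (j : ℤ) {y : F2} (ih : (∃ j : ℤ, y = gb ^ j) ∨ ∃ r : ℤ, ∃ p' ∈ aPos,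
      y = p' * (syl r false)⁻¹) : (∃ k : ℤ, y * gb ^ j = gb ^ k) ∨ ∃ r : ℤ, ∃ p' ∈ aPos,
      y * gb ^ j = p' * (syl r false)⁻¹ := by
    rcases ih with ⟨k, rfl⟩ | ⟨r, p', h, rfl⟩
    · exact .inl ⟨k + j, (zpow_add _ _ _).symm⟩
    · refine .inr ⟨r - j, p', h, ?_⟩
      simp only [syl, aPow_false]
      group
  induction hp using Submonoid.closure_induction_right with
  | one => exact .inl ⟨0, rfl⟩
  | mul_right y hy x hx ih =>
    rcases hx with rfl | rfl | rfl
    · exact .inr ⟨0, y, hy, by simp [syl]⟩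
    · simpa using hb 1 ih
    · simpa using hb (-1) ih

theorem dir_aPos {p : F2} (hp : p ∈ aPos) : dir p = none ∨ ∃ r, dir p = some (r, true) := by
  induction hp using Submonoid.closure_induction_left with
  | one => simp
  | mul_left x hx y hy ih =>
    rcases hx with rfl | rfl | rfl
    · refine .inr ⟨0, dir_aPow_mul (e := true) ?_⟩
      rcases ih with h | ⟨r, h⟩ <;> simp [h]
    · have := dir_zpow_mul 1 y
      rw [zpow_one] at this
      rcases ih with h | ⟨r, h⟩ <;> simp [h, this]
    · have := dir_zpow_mul (-1) y
      rw [zpow_neg_one] at this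
      rcases ih with h | ⟨r, h⟩ <;> simp [h, this]

theorem dir_aPos_inv {p : F2} (hp : p ∈ aPos) :
    dir p⁻¹ = none ∨ ∃ r, dir p⁻¹ = some (r, false) := by
  induction hp using Submonoid.closure_induction_right with
  | one => simp
  | mul_right y hy x hx ih =>
    rcases hx with rfl | rfl | rfl
    · refine .inr ⟨0, ?_⟩
      rw [mul_inv_rev]
      refine dir_aPow_mul (e := false) ?_
      rcases ih with h | ⟨r, h⟩ <;> simp [h]
    · have := dir_zpow_mul (-1) y⁻¹
      rw [zpow_neg_one] at this
      rcases ih with h | ⟨r, h⟩ <;> simp [h, this]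
    · have := dir_zpow_mul 1 y⁻¹
      rw [zpow_one] at this
      rcases ih with h | ⟨r, h⟩ <;> simp [h, this]

theorem expA_nonneg {p : F2} (hp : p ∈ aPos) : 0 ≤ expA p := by
  induction hp using Submonoid.closure_induction_left with
  | one => simp
  | mul_left x hx y hy ih => rcases hx with rfl | rfl | rfl <;> simp <;> omega

theorem eq_zpow_of_expA_eq_zero {p : F2} (hp : p ∈ aPos) (h : expA p = 0) :
    ∃ j : ℤ, p = gb ^ j := by
  rcases aPos_left hp with h1 | ⟨r, p', hp', rfl⟩
  · exact h1
  · have := expA_nonneg hp'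
    simp [syl] at h
    omega

theorem exists_dir_signed {p : F2} (hp : p ∈ aPos) (h : 0 < expA p) (e : Bool) :
    ∃ r, dir (signed p e) = some (r, e) := by
  have h0 : dir p ≠ none := by
    intro h1
    obtain ⟨j, rfl⟩ := dir_eq_none h1
    simp at h
  cases e
  · exact (dir_aPos_inv hp).resolve_left (dir_inv_ne_none h0)
  · exact (dir_aPos hp).resolve_left h0

/-- Moving the base vertex one step along the axis, forwards or backwards, cyclically rotates the
positive word. -/
theorem conj_syl_mem_aPos {p : F2} (hp : p ∈ aPos) {r : ℤ} {e : Bool}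
    (h : dir (signed p e) = some (r, e)) : (syl r e)⁻¹ * p * syl r e ∈ aPos := by
  cases e
  · rcases aPos_right hp with ⟨j, rfl⟩ | ⟨s, p', hp', rfl⟩
    · rw [signed_false, ← zpow_neg, dir_zpow] at h
      simp at h
    · rw [signed_false, mul_inv_rev, inv_inv, dir_syl_mul (by
        rcases dir_aPos_inv hp' with h | ⟨r, h⟩ <;> simp [h])] at h
      simp only [Option.some.injEq, Prod.mk.injEq, and_true] at h
      subst h
      have : (syl s false)⁻¹ * (p' * (syl s false)⁻¹) * syl s false = ga * gb ^ (-s) * p' := by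
        simp [syl, mul_assoc]
      rw [this]
      exact mul_mem (mul_mem ga_mem_aPos (zpow_mem_aPos _)) hp'
  · rcases aPos_left hp with ⟨j, rfl⟩ | ⟨s, p', hp', rfl⟩
    · rw [signed_true, dir_zpow] at h
      simp at h
    · rw [signed_true, dir_syl_mul (by
        rcases dir_aPos hp' with h | ⟨r, h⟩ <;> simp [h])] at h
      simp only [Option.some.injEq, Prod.mk.injEq, and_true] at h
      subst h
      have : (syl s true)⁻¹ * (syl s true * p') * syl s true = p' * (gb ^ s * ga) := by
        simp [syl, mul_assoc]
      rw [this]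
      exact mul_mem hp' (mul_mem (zpow_mem_aPos _) ga_mem_aPos)

/-- If neither translate of `g⟨b⟩` lies in its own direction, the paths from `g⟨b⟩` to both
translates begin by returning to the base vertex. They start in the same direction, whereas the two
rays of an axis have opposite signs of `a`. -/
theorem conj_not_mem_aPos {p g : F2} (hg : dir g ≠ none) (h1 : dir (p * g) ≠ dir g)
    (h2 : dir (p⁻¹ * g) ≠ dir g) : g⁻¹ * p * g ∉ aPos := by
  intro hq
  have hg' := dir_inv_ne_none hg
  have e1 : dir (g⁻¹ * p * g) = dir g⁻¹ := by
    rw [mul_assoc]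
    exact dir_mul hg' (by rw [inv_inv]; exact h1.symm)
  have e2 : dir (g⁻¹ * p * g)⁻¹ = dir g⁻¹ := by
    rw [show (g⁻¹ * p * g)⁻¹ = g⁻¹ * (p⁻¹ * g) by group]
    exact dir_mul hg' (by rw [inv_inv]; exact h2.symm)
  rcases dir_aPos hq with h | ⟨r, h⟩
  · exact hg' (by rw [← e1, h])
  · rcases dir_aPos_inv hq with h' | ⟨s, h'⟩
    · exact hg' (by rw [← e2, h'])
    · rw [e1] at h
      rw [e2, h] at h'
      simp at h'

/-- The axis of `p` passes through the base vertex: if it also passes through another vertex `g`,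
then `g` is in the direction of one of its two rays. -/
theorem dir_of_mem_axis {p g : F2} (hp : p ∈ aPos) (h : 0 < expA p) (hg : dir g ≠ none)
    (hq : g⁻¹ * p * g ∈ aPos) : ∃ e, dir g = dir (signed p e) := by
  by_contra! hc
  obtain ⟨r, hr⟩ := exists_dir_signed hp h true
  obtain ⟨s, hs⟩ := exists_dir_signed hp h false
  have ht := hc true
  have hf := hc false
  simp only [signed_true, signed_false] at hr hs ht hf
  refine conj_not_mem_aPos hg ?_ ?_ hq
  · rw [dir_mul (by simp [hr]) hf.symm]
    exact ht.symm
  · rw [dir_mul (by simp [hs]) (by rw [inv_inv]; exact ht.symm)]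
    exact hf.symm

/-- A nontrivial power of `b` rotates every direction at the base vertex, so it fixes no other
vertex. -/
theorem dir_eq_none_of_mem_axis {j : ℤ} (hj : j ≠ 0) {g : F2} (hq : g⁻¹ * gb ^ j * g ∈ aPos) :
    dir g = none := by
  by_contra hg
  obtain ⟨⟨r, e⟩, hd⟩ := Option.ne_none_iff_exists'.1 hg
  refine conj_not_mem_aPos hg ?_ ?_ hq
  · rw [dir_zpow_mul, hd]
    simpa using hj
  · rw [← zpow_neg, dir_zpow_mul, hd]
    simpa using hj

/-- An edge of the tree not touching the base vertex stays within one direction. -/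
theorem dir_mul_syl {g : F2} {r : ℤ} {e : Bool} (h1 : dir g ≠ none)
    (h2 : dir (g * syl r e) ≠ none) : dir (g * syl r e) = dir g := by
  by_cases h : dir g⁻¹ = some (r, e)
  · obtain ⟨k, hk, -⟩ := exists_eq_syl_mul h
    rw [hk] at h
    have h3 := dir_ne_of_dir_syl_mul h
    obtain rfl : g = k⁻¹ * (aPow (!e) * gb ^ (-r)) := by
      rw [← inv_inj, hk]
      simp [syl]
    have h4 : k⁻¹ * (aPow (!e) * gb ^ (-r)) * syl r e = k⁻¹ := by simp [syl, mul_assoc]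
    rw [h4] at h2 ⊢
    refine (dir_mul h2 ?_).symm
    rw [inv_inv, dir_aPow_mul (by rw [dir_zpow]; simp)]
    exact h3
  · refine dir_mul h1 ?_
    rwa [syl, dir_zpow_mul, ← mul_one (aPow e), dir_aPow_mul (by simp), Option.map_some, zero_add]

/-- The axis of an element that avoids the base vertex lies in one direction. -/
theorem dir_eq_of_axis {q h h' : F2} (hq1 : q ≠ 1) (hq : q ∉ aPos) (hh : h⁻¹ * q * h ∈ aPos)
    (hh' : h'⁻¹ * q * h' ∈ aPos) : dir h = dir h' := by
  have hne {g : F2} (hg : g⁻¹ * q * g ∈ aPos) : dir g ≠ none := by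
    intro h
    obtain ⟨j, rfl⟩ := dir_eq_none h
    apply hq
    have := mul_mem (mul_mem (zpow_mem_aPos j) hg) (zpow_mem_aPos (-j))
    convert this using 1
    group
  -- Walk along the axis from `h` towards `h'`; the base vertex is never met, so each edge preserves
  -- the direction.
  induction hn : norm (h⁻¹ * h') using Nat.strong_induction_on generalizing h with
  | _ n ih =>
    have hconj : (h⁻¹ * h')⁻¹ * (h⁻¹ * q * h) * (h⁻¹ * h') = h'⁻¹ * q * h' := by group
    by_cases hd : dir (h⁻¹ * h') = none
    · obtain ⟨j, hj⟩ := dir_eq_none hd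
      rw [← mul_inv_cancel_left h h', hj, dir_mul_zpow]
    · have hpos : 0 < expA (h⁻¹ * q * h) := by
        rcases (expA_nonneg hh).lt_or_eq with h1 | h1
        · exact h1
        · obtain ⟨j, hj⟩ := eq_zpow_of_expA_eq_zero hh h1.symm
          refine absurd (dir_eq_none_of_mem_axis (j := j) ?_ ?_) hd
          · rintro rfl
            rw [zpow_zero, mul_assoc, inv_mul_eq_one] at hj
            exact hq1 (by simpa using hj.symm)
          · rw [← hj, hconj]
            exact hh'
      obtain ⟨e, he⟩ := dir_of_mem_axis hh hpos hd (by rw [hconj]; exact hh')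
      obtain ⟨r, hr⟩ := exists_dir_signed hh hpos e
      obtain ⟨g', hg', hlt⟩ := exists_eq_syl_mul (he.trans hr)
      have h1 := conj_syl_mem_aPos hh hr
      have h2 : (h * syl r e)⁻¹ * q * (h * syl r e) ∈ aPos := by
        convert h1 using 1
        group
      rw [← dir_mul_syl (hne hh) (hne h2)]
      refine ih _ ?_ h2 rfl
      rw [mul_inv_rev, mul_assoc, hg', inv_mul_cancel_left, ← hn]
      exact hlt

/-! ### Turns along an axis. -/

/-- The submonoid generated by `a * b ^ N` and `a * b ^ (N + 1)`. -/
def turnMonoid (N : ℤ) : Submonoid F2 := Submonoid.closure {ga * gb ^ N, ga * gb ^ (N + 1)}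

theorem turnMonoid_le (N : ℤ) : turnMonoid N ≤ aPos := by
  rw [turnMonoid, Submonoid.closure_le]
  rintro x (rfl | rfl) <;> exact mul_mem ga_mem_aPos (zpow_mem_aPos _)

theorem mem_turnMonoid {N t : ℤ} (ht : t = N ∨ t = N + 1) : ga * gb ^ t ∈ turnMonoid N := by
  apply Submonoid.subset_closure
  rcases ht with rfl | rfl <;> simp

theorem turnMonoid_left {N : ℤ} {w : F2} (hw : w ∈ turnMonoid N) (h : w ≠ 1) :
    ∃ t, (t = N ∨ t = N + 1) ∧ ∃ w' ∈ turnMonoid N, w = ga * gb ^ t * w' := by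
  induction hw using Submonoid.closure_induction_left with
  | one => exact absurd rfl h
  | mul_left x hx y hy ih =>
    rcases hx with rfl | rfl
    · exact ⟨N, .inl rfl, y, hy, rfl⟩
    · exact ⟨N + 1, .inr rfl, y, hy, rfl⟩

theorem turnMonoid_right {N : ℤ} {w : F2} (hw : w ∈ turnMonoid N) (h : w ≠ 1) :
    ∃ t, (t = N ∨ t = N + 1) ∧ ∃ w' ∈ turnMonoid N, w = w' * (ga * gb ^ t) := by
  induction hw using Submonoid.closure_induction_right with
  | one => exact absurd rfl h
  | mul_right y hy x hx ih =>
    rcases hx with rfl | rfl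
    · exact ⟨N, .inl rfl, y, hy, rfl⟩
    · exact ⟨N + 1, .inr rfl, y, hy, rfl⟩

/-- The axis of `q` passes through the base vertex, and all its turns are `N` or `N + 1`. -/
def HasTurn (N : ℤ) (q : F2) : Prop :=
  ∃ j : ℤ, ∃ w ∈ turnMonoid N, w ≠ 1 ∧ q = gb ^ (-j) * w * gb ^ j

theorem HasTurn.mem_aPos {N : ℤ} {q : F2} (h : HasTurn N q) : q ∈ aPos := by
  obtain ⟨j, w, hw, -, rfl⟩ := h
  exact mul_mem (mul_mem (zpow_mem_aPos _) (turnMonoid_le N hw)) (zpow_mem_aPos _)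

theorem HasTurn.expA_pos {N : ℤ} {q : F2} (h : HasTurn N q) : 0 < expA q := by
  obtain ⟨j, w, hw, hw1, rfl⟩ := h
  obtain ⟨t, -, w', hw', rfl⟩ := turnMonoid_left hw hw1
  have := expA_nonneg (turnMonoid_le N hw')
  simp
  omega

theorem HasTurn.conj_zpow {N : ℤ} {q : F2} (h : HasTurn N q) (k : ℤ) :
    HasTurn N ((gb ^ k)⁻¹ * q * gb ^ k) := by
  obtain ⟨j, w, hw, hw1, rfl⟩ := h
  refine ⟨j + k, w, hw, hw1, ?_⟩
  rw [zpow_add, neg_add_rev, zpow_add]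
  group

theorem HasTurn.dir_signed {N : ℤ} {q : F2} (h : HasTurn N q) :
    ∃ j t w, (t = N ∨ t = N + 1) ∧ w ∈ turnMonoid N ∧ q = syl j true * (gb ^ t * w * gb ^ (-j)) ∧
      dir q = some (j, true) := by
  obtain ⟨j, w, hw, hw1, rfl⟩ := h
  obtain ⟨t, ht, w', hw', rfl⟩ := turnMonoid_left hw hw1
  have e : gb ^ (-j) * (ga * gb ^ t * w') * gb ^ j
    = syl (-j) true * (gb ^ t * w' * gb ^ (- -j)) := by simp [syl, mul_assoc]
  refine ⟨-j, t, w', ht, hw', e, ?_⟩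
  rw [e]
  apply dir_syl_mul
  rcases dir_aPos (mul_mem (mul_mem (zpow_mem_aPos t) (turnMonoid_le N hw'))
    (zpow_mem_aPos (- -j))) with h | ⟨r, h⟩ <;> rw [h] <;> simp

/-- The last factor `a * b ^ t` of the cyclic word, read across the base vertex, determines the
backward ray: the two `b`-exponents differ by the turn `t`. -/
theorem HasTurn.dir_inv {N : ℤ} {q : F2} (h : HasTurn N q) :
    ∃ j t w, (t = N ∨ t = N + 1) ∧ w ∈ turnMonoid N ∧ q = gb ^ (j + t) * w * (syl j false)⁻¹ ∧
      dir q = some (j + t, true) ∧ dir q⁻¹ = some (j, false) := by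
  obtain ⟨j₀, t₀, w₀, -, hw₀, e₀, hd⟩ := h.dir_signed
  obtain ⟨j, w, hw, hw1, rfl⟩ := h
  have hj : j₀ = -j := by
    obtain ⟨t, ht, w', hw', rfl⟩ := turnMonoid_left hw hw1
    have e : gb ^ (-j) * (ga * gb ^ t * w') * gb ^ j
      = syl (-j) true * (gb ^ t * w' * gb ^ j) := by simp [syl, mul_assoc]
    rw [e, dir_syl_mul] at hd
    · simpa using hd.symm
    · rcases dir_aPos (mul_mem (mul_mem (zpow_mem_aPos t) (turnMonoid_le N hw'))
        (zpow_mem_aPos j)) with h | ⟨r, h⟩ <;> rw [h] <;> simp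
  obtain ⟨t, ht, w', hw', rfl⟩ := turnMonoid_right hw hw1
  have e : gb ^ (-j) * (w' * (ga * gb ^ t)) * gb ^ j
      = gb ^ (-j) * w' * (syl (-j - t) false)⁻¹ := by
    simp only [syl, aPow_false]
    group
  refine ⟨-j - t, t, w', ht, hw', ?_, ?_, ?_⟩
  · rw [e, sub_add_cancel]
  · rw [hd, hj, sub_add_cancel]
  · rw [e, mul_inv_rev, inv_inv]
    apply dir_syl_mul
    rcases dir_aPos_inv (mul_mem (zpow_mem_aPos (-j)) (turnMonoid_le N hw')) with h | ⟨r, h⟩ <;>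
      rw [h] <;> simp

theorem HasTurn.conj_syl {N : ℤ} {q : F2} (h : HasTurn N q) {r : ℤ} {e : Bool}
    (hd : dir (signed q e) = some (r, e)) : HasTurn N ((syl r e)⁻¹ * q * syl r e) := by
  have hne (w : F2) (hw : w ∈ turnMonoid N) (t : ℤ) :
      0 < expA (w * (ga * gb ^ t)) := by
    have := expA_nonneg (turnMonoid_le N hw)
    simp
    omega
  cases e
  · obtain ⟨j, t, w, ht, hw, hq, -, hd'⟩ := h.dir_inv
    rw [signed_false, hd'] at hd
    simp only [Option.some.injEq, Prod.mk.injEq, and_true] at hd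
    subst hd
    refine ⟨0, ga * gb ^ t * w, mul_mem (mem_turnMonoid ht) hw, ?_, ?_⟩
    · intro h1
      have := congrArg expA h1
      have h2 := hne w hw t
      simp at this h2
      omega
    · rw [hq]
      simp only [syl, aPow_false]
      group
  · obtain ⟨j, t, w, ht, hw, hq, hd'⟩ := h.dir_signed
    rw [signed_true, hd'] at hd
    simp only [Option.some.injEq, Prod.mk.injEq, and_true] at hd
    subst hd
    refine ⟨-t, w * (ga * gb ^ t), mul_mem hw (mem_turnMonoid ht), ?_, ?_⟩
    · intro h1
      have := congrArg expA h1
      have h2 := hne w hw t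
      simp at this h2
      omega
    · rw [hq]
      simp only [syl, aPow_true]
      group

/-- Every vertex of the axis is reached by steps along it, each of which only rotates the word, so
the turn condition holds at all vertices once it holds at one. -/
theorem HasTurn.conj {N : ℤ} {q g : F2} (h : HasTurn N q) (hg : g⁻¹ * q * g ∈ aPos) :
    HasTurn N (g⁻¹ * q * g) := by
  induction hn : norm g using Nat.strong_induction_on generalizing g q with
  | _ n ih =>
    by_cases hd : dir g = none
    · obtain ⟨j, rfl⟩ := dir_eq_none hd
      exact h.conj_zpow j
    · obtain ⟨e, he⟩ := dir_of_mem_axis h.mem_aPos h.expA_pos hd hg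
      obtain ⟨r, hr⟩ := exists_dir_signed h.mem_aPos h.expA_pos e
      obtain ⟨g', rfl, hlt⟩ := exists_eq_syl_mul (he.trans hr)
      have e : (syl r e * g')⁻¹ * q * (syl r e * g') =
        g'⁻¹ * ((syl r e)⁻¹ * q * syl r e) * g' := by group
      rw [e] at hg ⊢
      exact ih _ (hn ▸ hlt) (h.conj_syl hr) hg rfl

/-! ### Standard bases and Nielsen moves. -/

/-- The pairs of positive words in `a * b ^ N` and `a * b ^ (N + 1)` obtained from these two letters
by positive elementary Nielsen transformations. -/
inductive PosPair (N : ℤ) : F2 → F2 → Prop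
  | base : PosPair N (ga * gb ^ N) (ga * gb ^ (N + 1))
  | left {X Y : F2} : PosPair N X Y → PosPair N (X * Y) Y
  | right {X Y : F2} : PosPair N X Y → PosPair N X (X * Y)

/-- The standard bases: `(a * b ^ n, b)` and the positive pairs. -/
def StdPair (X Y : F2) : Prop := (∃ n : ℤ, X = ga * gb ^ n ∧ Y = gb) ∨ ∃ N, PosPair N X Y

/-- `{x, y}` is a standard basis up to a common conjugation, inversions and order. -/
def IsStandard (x y : F2) : Prop :=
  ∃ g X Y e f, StdPair X Y ∧
    ((x = g * signed X e * g⁻¹ ∧ y = g * signed Y f * g⁻¹) ∨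
      (x = g * signed Y f * g⁻¹ ∧ y = g * signed X e * g⁻¹))

theorem StdPair.isStandard {X Y : F2} (h : StdPair X Y) : IsStandard X Y :=
  ⟨1, X, Y, true, true, h, .inl (by simp)⟩

theorem signed_not (g : F2) (e : Bool) : signed g (!e) = (signed g e)⁻¹ := by cases e <;> simp

namespace IsStandard

variable {x y : F2}

theorem symm (h : IsStandard x y) : IsStandard y x := by
  obtain ⟨g, X, Y, e, f, hs, h | h⟩ := h
  · exact ⟨g, X, Y, e, f, hs, .inr h.symm⟩
  · exact ⟨g, X, Y, e, f, hs, .inl h.symm⟩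

theorem inv_left (h : IsStandard x y) : IsStandard x⁻¹ y := by
  obtain ⟨g, X, Y, e, f, hs, ⟨h1, h2⟩ | ⟨h1, h2⟩⟩ := h
  · exact ⟨g, X, Y, !e, f, hs, .inl ⟨by rw [h1, signed_not]; group, h2⟩⟩
  · exact ⟨g, X, Y, e, !f, hs, .inr ⟨by rw [h1, signed_not]; group, h2⟩⟩

theorem inv_right (h : IsStandard x y) : IsStandard x y⁻¹ := h.symm.inv_left.symm

theorem conj (h : IsStandard x y) (k : F2) : IsStandard (k * x * k⁻¹) (k * y * k⁻¹) := by
  obtain ⟨g, X, Y, e, f, hs, ⟨rfl, rfl⟩ | ⟨rfl, rfl⟩⟩ := h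
  · exact ⟨k * g, X, Y, e, f, hs, .inl ⟨by group, by group⟩⟩
  · exact ⟨k * g, X, Y, e, f, hs, .inr ⟨by group, by group⟩⟩

theorem of_conj (k : F2) (h : IsStandard (k * x * k⁻¹) (k * y * k⁻¹)) : IsStandard x y := by
  have := h.conj k⁻¹
  convert this using 1 <;> group

theorem of_inv_left (h : IsStandard x⁻¹ y) : IsStandard x y := by simpa using h.inv_left

theorem of_inv_right (h : IsStandard x y⁻¹) : IsStandard x y := by simpa using h.inv_right

end IsStandard

theorem StdPair.mul_left {X Y : F2} (h : StdPair X Y) : IsStandard (X * Y) Y := by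
  rcases h with ⟨n, rfl, rfl⟩ | ⟨N, h⟩
  · exact StdPair.isStandard (.inl ⟨n + 1, by rw [zpow_add_one, mul_assoc], rfl⟩)
  · exact StdPair.isStandard (.inr ⟨N, h.left⟩)

theorem StdPair.mul_right {X Y : F2} (h : StdPair X Y) : IsStandard X (X * Y) := by
  rcases h with ⟨n, rfl, rfl⟩ | ⟨N, h⟩
  · refine StdPair.isStandard (.inr ⟨n, ?_⟩)
    rw [mul_assoc, ← zpow_add_one]
    exact .base
  · exact StdPair.isStandard (.inr ⟨N, h.right⟩)

/-- An inverse move either undoes the last positive move or, after conjugation, becomes a positive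
move on the preceding pair. On the base pair the quotient is conjugate to `b⁻¹`, which leads back to
a pair of the first kind. -/
theorem StdPair.mul_inv_left {X Y : F2} (h : StdPair X Y) : IsStandard (X * Y⁻¹) Y := by
  rcases h with ⟨n, rfl, rfl⟩ | ⟨N, h⟩
  · exact StdPair.isStandard (.inl ⟨n - 1, by rw [zpow_sub_one, mul_assoc], rfl⟩)
  · cases h with
    | base =>
      have h : IsStandard (ga * gb ^ (N + 1)) gb := StdPair.isStandard (.inl ⟨N + 1, rfl, rfl⟩)
      refine .of_inv_left (.of_conj ga⁻¹ (.of_conj (gb ^ (-(N + 1))) ?_))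
      convert h.symm using 1 <;> group
    | @left X' Y' h => simpa using StdPair.isStandard (.inr ⟨N, h⟩)
    | @right _ Y' h =>
      refine .of_conj X⁻¹ (.of_conj Y'⁻¹ (.of_inv_left ?_))
      convert (StdPair.isStandard (.inr ⟨N, h.left⟩)).symm using 1 <;> group

theorem StdPair.mul_inv_right {X Y : F2} (h : StdPair X Y) : IsStandard X (X * Y⁻¹) := by
  rcases h with ⟨n, rfl, rfl⟩ | ⟨N, h⟩
  · refine (StdPair.isStandard (.inr ⟨n - 1, ?_⟩)).symm
    rw [mul_assoc, ← zpow_sub_one]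
    convert PosPair.base using 2
    rw [sub_add_cancel]
  · cases h with
    | base =>
      have h : IsStandard (ga * gb ^ N) gb := StdPair.isStandard (.inl ⟨N, rfl, rfl⟩)
      refine .of_conj ga⁻¹ (.of_conj (gb ^ (-N)) (.of_inv_right ?_))
      convert h using 1 <;> group
    | @left X' Y' h => simpa using (StdPair.isStandard (.inr ⟨N, h.right⟩)).symm
    | @right _ Y' h =>
      refine .of_conj X⁻¹ (.of_inv_right ?_)
      convert StdPair.isStandard (.inr ⟨N, h⟩) using 1 <;> group

theorem IsStandard.mul_left {x y : F2} (h : IsStandard x y) : IsStandard (x * y) y := by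
  obtain ⟨g, X, Y, e, f, hs, h⟩ := h
  have key : IsStandard (signed X e * signed Y f) (signed Y f) ∧
      IsStandard (signed Y f * signed X e) (signed X e) := by
    have h1 := hs.mul_left
    have h2 := hs.mul_inv_left
    have h3 := hs.mul_right
    have h4 := hs.mul_inv_right
    cases e <;> cases f <;> simp only [signed_true, signed_false]
    · refine ⟨.of_inv_left (.of_inv_right (.of_conj Y⁻¹ ?_)), .of_inv_left (.of_inv_right ?_)⟩
      · convert h1 using 1 <;> group
      · convert h3.symm using 1 <;> group
    · refine ⟨.of_inv_left (.of_conj Y ?_), .of_inv_left (.of_inv_right ?_)⟩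
      · convert h2 using 1 <;> group
      · convert h4.symm using 1 <;> group
    · refine ⟨h2.inv_right, .of_inv_left (.of_conj X (.of_inv_left ?_))⟩
      convert h4.symm using 1 <;> group
    · refine ⟨h1, .of_conj X ?_⟩
      convert h3.symm using 1 <;> group
  rcases h with ⟨rfl, rfl⟩ | ⟨rfl, rfl⟩
  · convert key.1.conj g using 1; group
  · convert key.2.conj g using 1; group

theorem IsStandard.mul_right {x y : F2} (h : IsStandard x y) : IsStandard x (x * y) := by
  have := h.symm.inv_left.inv_right.mul_left.inv_left.inv_right.symm
  simpa using this

theorem IsStandard.of_mul_left {x y : F2} (h : IsStandard (x * y) y) : IsStandard x y := by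
  have := h.inv_right.mul_left.of_inv_right
  simpa using this

theorem IsStandard.of_mul_right {x y : F2} (h : IsStandard x (x * y)) : IsStandard x y := by
  have := h.inv_left.mul_right.of_inv_left
  simpa using this

/-! ### Nielsen's theorem in rank two. -/

/-- `x` and `y` generate `F2`. -/
def Generate (x y : F2) : Prop := Subgroup.closure {x, y} = ⊤

theorem Generate.of_mem {x y x' y' : F2} (h : Generate x y) (hx : x ∈ Subgroup.closure {x', y'})
    (hy : y ∈ Subgroup.closure {x', y'}) : Generate x' y' := by
  rw [Generate, eq_top_iff, ← h, Subgroup.closure_le]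
  rintro z (rfl | rfl)
  · exact hx
  · exact hy

theorem fst_mem_closure (x y : F2) : x ∈ Subgroup.closure {x, y} :=
  Subgroup.subset_closure (by simp)

theorem snd_mem_closure (x y : F2) : y ∈ Subgroup.closure {x, y} :=
  Subgroup.subset_closure (by simp)

namespace Generate

variable {x y : F2}

theorem symm (h : Generate x y) : Generate y x :=
  h.of_mem (snd_mem_closure _ _) (fst_mem_closure _ _)

theorem inv_left (h : Generate x y) : Generate x⁻¹ y :=
  h.of_mem (inv_mem_iff.1 (fst_mem_closure _ _)) (snd_mem_closure _ _)

theorem inv_right (h : Generate x y) : Generate x y⁻¹ := h.symm.inv_left.symm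

theorem mul_left (h : Generate x y) : Generate (x * y) y :=
  h.of_mem ((Subgroup.mul_mem_cancel_right _ (snd_mem_closure _ _)).1 (fst_mem_closure _ _))
    (snd_mem_closure _ _)

theorem mul_right (h : Generate x y) : Generate x (x * y) :=
  h.of_mem (fst_mem_closure _ _)
    ((Subgroup.mul_mem_cancel_left _ (fst_mem_closure _ _)).1 (snd_mem_closure _ _))

theorem map (h : Generate x y) (f : F2 →* F2) (hf : Function.Surjective f) :
    Generate (f x) (f y) := by
  have := MonoidHom.map_closure f {x, y}
  rw [Generate] at *
  rw [h, Subgroup.map_top_of_surjective f hf, Set.image_pair] at this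
  exact this.symm

theorem conj (h : Generate x y) (g : F2) : Generate (g⁻¹ * x * g) (g⁻¹ * y * g) := by
  simpa using h.map (MulAut.conj g⁻¹).toMonoidHom (MulAut.conj g⁻¹).surjective

theorem fst_ne_snd (h : Generate x y) : x ≠ y := by
  rintro rfl
  have hz : ∀ g : F2, g ∈ Subgroup.zpowers x := by
    intro g
    have : g ∈ Subgroup.closure {x, x} := by rw [h]; trivial
    rwa [Set.pair_eq_singleton, ← Subgroup.zpowers_eq_closure] at this
  obtain ⟨m, hm⟩ := hz ga
  obtain ⟨n, hn⟩ := hz gb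
  have hc : ga * gb = gb * ga := by
    rw [← hm, ← hn]
    exact (Commute.refl x).zpow_zpow m n
  exact absurd hc (by decide)

theorem left_ne_one (h : Generate x y) : x ≠ 1 := by
  rintro rfl
  exact h.mul_left.fst_ne_snd (one_mul y)

end Generate

/-- The letters of a pair of generators. -/
def letters (x y : F2) : Set F2 := {x, x⁻¹, y, y⁻¹}

theorem mem_letters_cases {x y u v w : F2} (hu : u ∈ letters x y) (hv : v ∈ letters x y)
    (hw : w ∈ letters x y) (h1 : u ≠ v) (h2 : u * v ≠ 1) :
    w = u ∨ w = u⁻¹ ∨ w = v ∨ w = v⁻¹ := by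
  rcases hu with rfl | rfl | rfl | rfl <;> rcases hv with rfl | rfl | rfl | rfl <;>
    rcases hw with rfl | rfl | rfl | rfl <;> simp_all

/-- A generating pair of minimal length among those that are not standard. -/
def MinBad (x y : F2) : Prop :=
  Generate x y ∧ ¬ IsStandard x y ∧
    ∀ x' y', Generate x' y' → ¬ IsStandard x' y' → norm x + norm y ≤ norm x' + norm y'

namespace MinBad

variable {x y : F2}

theorem symm (h : MinBad x y) : MinBad y x :=
  ⟨h.1.symm, fun hs => h.2.1 hs.symm, fun x' y' h1 h2 => by
    rw [add_comm]
    exact h.2.2 x' y' h1 h2⟩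

theorem inv_left (h : MinBad x y) : MinBad x⁻¹ y :=
  ⟨h.1.inv_left, fun hs => h.2.1 hs.of_inv_left, by rw [norm_inv_eq]; exact h.2.2⟩

theorem inv_right (h : MinBad x y) : MinBad x y⁻¹ := h.symm.inv_left.symm

/-- If more than half of `x` cancelled, replacing `y` by `x * y` would shorten the pair. -/
theorem gromov_le_left (h : MinBad x y) : 2 * gromov x⁻¹ y ≤ norm x := by
  have := h.2.2 _ _ h.1.mul_right fun hs => h.2.1 hs.of_mul_right
  have := norm_mul x y
  omega

theorem gromov_le_right (h : MinBad x y) : 2 * gromov x⁻¹ y ≤ norm y := by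
  have := h.2.2 _ _ h.1.mul_left fun hs => h.2.1 hs.of_mul_left
  have := norm_mul x y
  omega

/-- Suppose `x = p * s` with halves of equal length and `y = s⁻¹ * y' * p⁻¹`. Conjugating `(x, x *
y)` by `p` gives `(s * p, y')`, which is shorter. Conjugation thus replaces the usual well-ordering
argument for ties. -/
theorem not_half (h : MinBad x y) :
    ¬ (2 * gromov y⁻¹ x = norm x ∧ 2 * gromov x⁻¹ y = norm x) := by
  rintro ⟨h1, h2⟩
  obtain ⟨p, hp1, hp2⟩ := exists_prefix x (k := gromov x⁻¹ y) (by omega)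
  have hx : norm x ≠ 0 := fun h0 => h.1.left_ne_one (norm_eq_zero.1 h0)
  have hy := h.symm.gromov_le_left
  have e0 := norm_mul x y
  have e1 := norm_inv_mul (x * y) x
  rw [show (x * y)⁻¹ * x = y⁻¹ * x⁻¹ * x by group, inv_mul_cancel_right, norm_inv_eq] at e1
  have e2 := norm_inv_mul (x * y)⁻¹ y⁻¹
  rw [inv_inv, mul_inv_cancel_right, norm_inv_eq, norm_inv_eq] at e2
  have u1 := gromov_ultra (x * y)⁻¹ y⁻¹ x
  have u2 := gromov_ultra p x (x * y)
  rw [gromov_comm x] at u2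
  have u3 := gromov_ultra p x (x * y)⁻¹
  rw [gromov_comm x] at u3
  have e3 := norm_inv_mul p (x * y)
  have e4 := norm_inv_mul p x
  have e5 := norm_mul_le (p⁻¹ * x) p
  have e6 := norm_mul (p⁻¹ * (x * y)) p
  have e7 := norm_inv_mul (p⁻¹ * (x * y))⁻¹ (x * y)⁻¹
  rw [inv_inv, mul_inv_cancel_right, norm_inv_eq, norm_inv_eq, norm_inv_eq] at e7
  have u4 := gromov_ultra (p⁻¹ * (x * y))⁻¹ (x * y)⁻¹ p
  rw [gromov_comm _ p] at u4
  have hmin := h.2.2 _ _ (h.1.mul_right.conj p) fun hs => h.2.1 <|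
    IsStandard.of_mul_right <| IsStandard.of_conj p⁻¹ (by simpa using hs)
  have e8 : norm (p⁻¹ * (x * y)) ≤ norm p⁻¹ + norm (x * y) := norm_mul_le _ _
  omega

theorem of_letters (h : MinBad x y) {u v : F2} (hu : u ∈ letters x y) (hv : v ∈ letters x y)
    (huv : u * v ≠ 1) : u = v ∨ MinBad u v := by
  have h1 := h.inv_left
  have h2 := h.inv_right
  have h3 := h1.inv_right
  rcases hu with rfl | rfl | rfl | rfl <;> rcases hv with rfl | rfl | rfl | rfl <;>
    first
    | exact .inl rfl
    | exact .inr (by assumption)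
    | exact .inr (MinBad.symm (by assumption))
    | (exfalso; apply huv; group)

theorem letter_ne_one (h : MinBad x y) {u : F2} (hu : u ∈ letters x y) : u ≠ 1 := by
  rcases hu with rfl | rfl | rfl | rfl
  · exact h.1.left_ne_one
  · exact h.1.inv_left.left_ne_one
  · exact h.1.symm.left_ne_one
  · exact h.1.symm.inv_left.left_ne_one

theorem gromov_self_lt {u : F2} (hu : u ≠ 1) : 2 * gromov u⁻¹ u < norm u := by
  have h1 := norm_mul u u
  have h2 := norm_lt_norm_mul_self hu
  omega

theorem gromov_letters (h : MinBad x y) {u v : F2} (hu : u ∈ letters x y) (hv : v ∈ letters x y)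
    (huv : u * v ≠ 1) : 2 * gromov u⁻¹ v ≤ norm u ∧ 2 * gromov u⁻¹ v ≤ norm v := by
  rcases h.of_letters hu hv huv with rfl | h'
  · have := gromov_self_lt (h.letter_ne_one hu)
    omega
  · exact ⟨h'.gromov_le_left, h'.gromov_le_right⟩

/-- At most half of `v` cancels on each side, so failure means exactly half on both. A third letter
different from `v` and `v⁻¹` must be `u` or `u⁻¹`: the first is excluded by `not_half`, the second
would make `v` and `v⁻¹` share half their length. -/
theorem gromov_letters_add (h : MinBad x y) {u v w : F2} (hu : u ∈ letters x y)
    (hv : v ∈ letters x y) (hw : w ∈ letters x y) (huv : u * v ≠ 1) (hvw : v * w ≠ 1) :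
    gromov u⁻¹ v + gromov v⁻¹ w < norm v := by
  have h1 := h.gromov_letters hu hv huv
  have h2 := h.gromov_letters hv hw hvw
  have h3 := gromov_self_lt (h.letter_ne_one hv)
  rcases h.of_letters hu hv huv with rfl | h4
  · omega
  rcases h.of_letters hv hw hvw with rfl | h5
  · omega
  have hcases : w = u ∨ w = u⁻¹ := by
    by_contra! hc
    have hne : u ≠ v := h4.1.fst_ne_snd
    have hw' := mem_letters_cases hu hv hw hne huv
    have hvw' : w ≠ v⁻¹ := fun e => hvw (by rw [e, mul_inv_cancel])
    have hvw2 : w ≠ v := h5.1.fst_ne_snd.symm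
    tauto
  rcases hcases with rfl | rfl
  · have := h4.symm.not_half
    omega
  · have := gromov_ultra v u⁻¹ v⁻¹
    rw [gromov_comm v, gromov_comm u⁻¹ v⁻¹, gromov_comm v v⁻¹] at this
    omega

end MinBad

/-- Reduced products of letters, together with their last letters. -/
inductive ReducedProd (G : Set F2) : F2 → F2 → Prop
  | base {z : F2} : z ∈ G → ReducedProd G z z
  | step {g z w : F2} : ReducedProd G g z → w ∈ G → z * w ≠ 1 → ReducedProd G (g * w) w

theorem ReducedProd.mem {G : Set F2} {g z : F2} (h : ReducedProd G g z) : z ∈ G := by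
  cases h <;> assumption

theorem ReducedProd.mul {G : Set F2} {g z w : F2} (h : ReducedProd G g z) (hw : w ∈ G) :
    g * w = 1 ∨ ∃ z', ReducedProd G (g * w) z' := by
  by_cases h1 : z * w = 1
  · obtain rfl := eq_inv_of_mul_eq_one_right h1
    cases h with
    | base hz => exact .inl h1
    | step hg hz hne => exact .inr ⟨_, by rwa [mul_inv_cancel_right]⟩
  · exact .inr ⟨_, h.step hw h1⟩

theorem exists_reducedProd {x y g : F2} (h : g ∈ Subgroup.closure {x, y}) :
    g = 1 ∨ ∃ z, ReducedProd (letters x y) g z := by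
  have key : ∀ g w : F2, w ∈ letters x y → (g = 1 ∨ ∃ z, ReducedProd (letters x y) g z) →
      (g * w = 1 ∨ ∃ z, ReducedProd (letters x y) (g * w) z) := by
    rintro g w hw (rfl | ⟨z, hz⟩)
    · exact .inr ⟨w, by simpa using .base hw⟩
    · exact hz.mul hw
  induction h using Subgroup.closure_induction_right with
  | one => exact .inl rfl
  | mul_right g hg w hw ih => exact key _ _ (by rcases hw with rfl | rfl <;> simp [letters]) ih
  | mul_inv_cancel g hg w hw ih =>
    exact key _ _ (by rcases hw with rfl | rfl <;> simp [letters]) ih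

/-- The first conclusion is the induction invariant: more of the last letter survives at the end of
`g` than the next letter can cancel. Cancellation therefore never reaches earlier letters, and
multiplying by a further letter does not decrease the length. -/
theorem MinBad.norm_reducedProd {x y g z : F2} (h : MinBad x y)
    (hg : ReducedProd (letters x y) g z) :
    (∀ w ∈ letters x y, z * w ≠ 1 → gromov z⁻¹ w < gromov g⁻¹ z⁻¹) ∧ (g = z ∨ 2 ≤ norm g) := by
  have hpos {u : F2} (hu : u ∈ letters x y) : norm u ≠ 0 :=
    fun h0 => h.letter_ne_one hu (norm_eq_zero.1 h0)
  induction hg with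
  | @base z hz =>
    refine ⟨fun w hw hne => ?_, .inl rfl⟩
    have h1 := norm_inv_mul z⁻¹ z⁻¹
    have h2 := h.gromov_letters hz hw hne
    have h3 := hpos hz
    rw [inv_mul_cancel, FreeGroup.norm_one, norm_inv_eq] at h1
    omega
  | @step g z w hg hw hne ih =>
    have h1 := ih.1 w hw hne
    have u1 := gromov_ultra g⁻¹ z⁻¹ w
    have u2 := gromov_ultra z⁻¹ g⁻¹ w
    rw [gromov_comm z⁻¹ g⁻¹] at u2
    have h2 := norm_mul g w
    have h3 := h.gromov_letters hg.mem hw hne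
    have h4 := hpos hw
    have h5 := hpos hg.mem
    refine ⟨fun w' hw' hne' => ?_, .inr ?_⟩
    · have h6 := h.gromov_letters_add hg.mem hw hw' hne hne'
      have h7 := norm_inv_mul (g * w)⁻¹ w⁻¹
      rw [inv_inv, mul_inv_cancel_right, norm_inv_eq, norm_inv_eq] at h7
      omega
    · rcases ih.2 with rfl | h8 <;> omega

/-- Nielsen's theorem in rank two: every generating pair is standard. -/
theorem Generate.isStandard {x y : F2} (h : Generate x y) : IsStandard x y := by
  induction hn : norm x + norm y using Nat.strong_induction_on generalizing x y with
  | _ n ih =>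
    by_contra hs
    have hmin : MinBad x y := by
      refine ⟨h, hs, fun x' y' h' hs' => ?_⟩
      by_contra! hlt
      exact hs' (ih _ (hn ▸ hlt) h' rfl)
    -- A free generator has length one, so its expression as a reduced product is a single letter.
    have key (c : Fin 2) : of c ∈ letters x y := by
      have hc : of c ∈ Subgroup.closure {x, y} := by rw [h]; trivial
      rcases exists_reducedProd hc with h1 | ⟨z, hz⟩
      · exact absurd h1 (of_ne_one c)
      · rcases (hmin.norm_reducedProd hz).2 with h1 | h1
        · rw [h1]
          exact hz.mem
        · rw [norm_of] at h1
          omega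
    have hab : IsStandard ga gb := StdPair.isStandard (.inl ⟨0, by simp, rfl⟩)
    have hne : ga * gb ≠ 1 := by decide
    rcases hmin.of_letters (key 0) (key 1) hne with h1 | h1
    · exact absurd h1 (by decide)
    · exact h1.2.1 hab

/-! ### Relative position of the axes of a generating pair. -/

theorem PosPair.mem {N : ℤ} {X Y : F2} (h : PosPair N X Y) :
    (X ∈ turnMonoid N ∧ Y ∈ turnMonoid N) ∧ 0 < expA X ∧ 0 < expA Y := by
  induction h with
  | base => exact ⟨⟨mem_turnMonoid (.inl rfl), mem_turnMonoid (.inr rfl)⟩, by simp, by simp⟩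
  | left h ih => exact ⟨⟨mul_mem ih.1.1 ih.1.2, ih.1.2⟩, by simp; omega, ih.2.2⟩
  | right h ih => exact ⟨⟨ih.1.1, mul_mem ih.1.1 ih.1.2⟩, ih.2.1, by simp; omega⟩

theorem hasTurn_of_mem {N : ℤ} {w : F2} (hw : w ∈ turnMonoid N) (h : 0 < expA w) :
    HasTurn N w :=
  ⟨0, w, hw, by rintro rfl; simp at h, by simp⟩

theorem eq_true_of_expA_nonneg {X g : F2} {e : Bool} (hX : 0 < expA X)
    (h : 0 ≤ expA (g * signed X e * g⁻¹)) : e = true := by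
  cases e
  · simp at h
    omega
  · rfl

theorem conj_inv_conj (g q : F2) : g⁻¹ * (g * q * g⁻¹) * g = q := by group

theorem dir_of_mem_turnMonoid {N : ℤ} {w : F2} (hw : w ∈ turnMonoid N) (h : 0 < expA w) :
    dir w = some (0, true) := by
  obtain ⟨t, -, w', hw', rfl⟩ := turnMonoid_left hw (by rintro rfl; simp at h)
  rw [mul_assoc]
  refine dir_aPow_mul (e := true) ?_
  rcases dir_aPos (mul_mem (zpow_mem_aPos t) (turnMonoid_le N hw')) with h | ⟨r, h⟩ <;> simp [h]

/-- The two possible positions of a generating pair relative to the splitting `⟨b⟩ *_1`. -/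
theorem Generate.cases {q q' : F2} (h : Generate q q') (h0 : 0 ≤ expA q) (h1 : 0 ≤ expA q') :
    (∃ g N, (g⁻¹ * q * g ∈ turnMonoid N ∧ 0 < expA (g⁻¹ * q * g)) ∧
      g⁻¹ * q' * g ∈ turnMonoid N ∧ 0 < expA (g⁻¹ * q' * g)) ∨
    (∃ g n e, q = g * (ga * gb ^ (n : ℤ)) * g⁻¹ ∧ q' = g * signed gb e * g⁻¹) ∨
    (∃ g n e, q' = g * (ga * gb ^ (n : ℤ)) * g⁻¹ ∧ q = g * signed gb e * g⁻¹) := by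
  obtain ⟨g, X, Y, e, f, hs, h⟩ := h.isStandard
  have hX : 0 < expA X := by
    rcases hs with ⟨n, rfl, rfl⟩ | ⟨N, hp⟩
    · simp
    · exact hp.mem.2.1
  have he : e = true := by
    rcases h with ⟨rfl, rfl⟩ | ⟨rfl, rfl⟩
    · exact eq_true_of_expA_nonneg hX h0
    · exact eq_true_of_expA_nonneg hX h1
  subst he
  rcases hs with ⟨n, rfl, rfl⟩ | ⟨N, hp⟩
  · rcases h with ⟨rfl, rfl⟩ | ⟨rfl, rfl⟩
    · exact .inr (.inl ⟨g, n, f, rfl, rfl⟩)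
    · exact .inr (.inr ⟨g, n, f, rfl, rfl⟩)
  · have hf : f = true := by
      rcases h with ⟨rfl, rfl⟩ | ⟨rfl, rfl⟩
      · exact eq_true_of_expA_nonneg hp.mem.2.2 h1
      · exact eq_true_of_expA_nonneg hp.mem.2.2 h0
    subst hf
    have a1 := And.intro hp.mem.1.1 hp.mem.2.1
    have a2 := And.intro hp.mem.1.2 hp.mem.2.2
    left
    refine ⟨g, N, ?_⟩
    rcases h with ⟨rfl, rfl⟩ | ⟨rfl, rfl⟩
    · simpa only [conj_inv_conj, signed_true] using ⟨a1, a2⟩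
    · simpa only [conj_inv_conj, signed_true] using ⟨a2, a1⟩

theorem signed_gb (e : Bool) : ∃ j : ℤ, j ≠ 0 ∧ signed gb e = gb ^ j := by
  cases e
  · exact ⟨-1, by simp, by simp⟩
  · exact ⟨1, by simp, by simp⟩

/-- The axes of two elements that generate `F2` have a common vertex. -/
theorem Generate.exists_common {q q' : F2} (h : Generate q q') (h0 : 0 ≤ expA q)
    (h1 : 0 ≤ expA q') : ∃ g, g⁻¹ * q * g ∈ aPos ∧ g⁻¹ * q' * g ∈ aPos := by
  have hn (n : ℤ) : ga * gb ^ n ∈ aPos := mul_mem ga_mem_aPos (zpow_mem_aPos n)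
  have he (e : Bool) : signed gb e ∈ aPos := by
    obtain ⟨j, -, hj⟩ := signed_gb e
    rw [hj]
    exact zpow_mem_aPos j
  rcases h.cases h0 h1 with ⟨g, N, h2, h3⟩ | ⟨g, n, e, rfl, rfl⟩ | ⟨g, n, e, rfl, rfl⟩
  · exact ⟨g, turnMonoid_le N h2.1, turnMonoid_le N h3.1⟩
  · exact ⟨g, by rw [conj_inv_conj]; exact hn n, by rw [conj_inv_conj]; exact he e⟩
  · exact ⟨g, by rw [conj_inv_conj]; exact he e, by rw [conj_inv_conj]; exact hn n⟩

theorem expA_conj (g q : F2) : expA (g * q * g⁻¹) = expA q := by simp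

theorem expA_conj' (g q : F2) : expA (g⁻¹ * q * g) = expA q := by simp

theorem expA_signed_gb (e : Bool) : expA (signed gb e) = 0 := by cases e <;> simp

/-- A positive exponent sum rules out conjugates of `b ^ (±1)`. The standard form gives the turn
condition at some vertex of the axis, and `HasTurn.conj` carries it to the base vertex. -/
theorem Generate.exists_hasTurn {q q' : F2} (h : Generate q q') (h0 : 0 < expA q)
    (h1 : 0 ≤ expA q') (hq : q ∈ aPos) : ∃ N, HasTurn N q := by
  have key {g N} (h : HasTurn N (g⁻¹ * q * g)) : HasTurn N q := by
    have := h.conj (g := g⁻¹) (by convert hq using 1; group)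
    convert this using 1
    group
  rcases h.cases h0.le h1 with ⟨g, N, h2, -⟩ | ⟨g, n, e, rfl, rfl⟩ | ⟨g, n, e, rfl, rfl⟩
  · exact ⟨N, key (hasTurn_of_mem h2.1 h2.2)⟩
  · refine ⟨n, key (g := g) ?_⟩
    rw [conj_inv_conj]
    exact hasTurn_of_mem (mem_turnMonoid (.inl rfl)) (by simp)
  · rw [expA_conj, expA_signed_gb] at h0
    exact absurd h0 (lt_irrefl _)

theorem Generate.eq_conj_gb {q q' : F2} (h : Generate q q') (h0 : expA q = 0)
    (h1 : 0 ≤ expA q') : ∃ g e, q = g * signed gb e * g⁻¹ := by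
  rcases h.cases h0.ge h1 with ⟨g, N, h2, -⟩ | ⟨g, n, e, rfl, rfl⟩ | ⟨g, n, e, rfl, rfl⟩
  · rw [expA_conj'] at h2
    omega
  · rw [expA_conj] at h0
    simp at h0
  · exact ⟨g, e, rfl⟩

/-- The axis of `q` passes through the base vertex, with directions `(D e, e)`. -/
def Through (q : F2) (D : Bool → ℤ) : Prop :=
  q ∈ aPos ∧ ∀ e, dir (signed q e) = some (D e, e)

theorem exists_through {q : F2} (hq : q ∈ aPos) (h : 0 < expA q) : ∃ D, Through q D := by
  choose D hD using exists_dir_signed hq h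
  exact ⟨D, hq, hD⟩

theorem Through.expA_pos {q : F2} {D : Bool → ℤ} (h : Through q D) : 0 < expA q := by
  refine lt_of_le_of_ne (expA_nonneg h.1) fun h0 => ?_
  obtain ⟨j, rfl⟩ := eq_zpow_of_expA_eq_zero h.1 h0.symm
  have := h.2 true
  rw [signed_true, dir_zpow] at this
  simp at this

theorem Through.dir {q g : F2} {D : Bool → ℤ} (h : Through q D) (hg : dir g ≠ none)
    (hq : g⁻¹ * q * g ∈ aPos) : ∃ e, dir g = some (D e, e) := by
  obtain ⟨e, he⟩ := dir_of_mem_axis h.1 h.expA_pos hg hq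
  exact ⟨e, he.trans (h.2 e)⟩

/-- At the next vertex of the axis, the ray pointing back to the old base vertex is `a ^ (∓1)`, with
`b`-exponent zero. -/
theorem Through.conj_syl {q : F2} {D : Bool → ℤ} (h : Through q D) (e : Bool) :
    ∃ D', Through ((syl (D e) e)⁻¹ * q * syl (D e) e) D' ∧ D' (!e) = 0 := by
  obtain ⟨D', hD'⟩ := exists_through (conj_syl_mem_aPos h.1 (h.2 e))
    (by rw [expA_conj']; exact h.expA_pos)
  refine ⟨D', hD', ?_⟩
  have hd : _root_.dir (syl (D e) e)⁻¹ = some (0, !e) := by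
    rw [syl, mul_inv_rev, ← aPow_not, ← zpow_neg]
    exact dir_aPow_mul (by rw [dir_zpow]; simp)
  obtain ⟨e', he'⟩ := hD'.dir (g := (syl (D e) e)⁻¹) (by rw [hd]; simp)
    (by convert h.1 using 1; group)
  rw [hd] at he'
  simp only [Option.some.injEq, Prod.mk.injEq] at he'
  obtain ⟨h1, rfl⟩ := he'
  exact h1.symm

theorem HasTurn.turn {N : ℤ} {q : F2} {D : Bool → ℤ} (h : HasTurn N q) (hD : Through q D) :
    D true - D false = N ∨ D true - D false = N + 1 := by
  obtain ⟨j, t, w, ht, -, -, h1, h2⟩ := h.dir_inv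
  have h3 := hD.2 true
  have h4 := hD.2 false
  rw [signed_true, h1] at h3
  rw [signed_false, h2] at h4
  simp only [Option.some.injEq, Prod.mk.injEq, and_true] at h3 h4
  omega

/-! ### Paths avoiding a ball and the twist estimate. -/

/-- The elements whose reduced words contain at most `n` letters `a` or `a⁻¹`. -/
inductive InBall : ℕ → F2 → Prop
  | zpow (n : ℕ) (j : ℤ) : InBall n (gb ^ j)
  | syl_mul {n : ℕ} {g : F2} (r : ℤ) (e : Bool) : InBall n g → InBall (n + 1) (syl r e * g)

theorem InBall.mono {m n : ℕ} {g : F2} (h : InBall m g) (hmn : m ≤ n) : InBall n g := by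
  induction h generalizing n with
  | zpow m j => exact .zpow n j
  | syl_mul r e h ih =>
    obtain ⟨n, rfl⟩ := Nat.exists_eq_add_of_le' (Nat.le_of_add_left_le hmn)
    exact .syl_mul r e (ih (by omega))

/-- A path of pairwise generating elements whose interior avoids the ball of radius `R`. -/
structure AvoidPath (q : ℕ → F2) (n R : ℕ) : Prop where
  nonneg : ∀ i ≤ n, 0 ≤ expA (q i)
  generate : ∀ i < n, Generate (q i) (q (i + 1))
  avoid : ∀ i, 0 < i → i < n → ∀ g e, InBall R g → q i ≠ g * signed gb e * g⁻¹

namespace AvoidPath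

variable {q : ℕ → F2} {n R : ℕ}

theorem sub (h : AvoidPath q n R) {i m R' : ℕ} (hm : i + m ≤ n) (hR : R' ≤ R) :
    AvoidPath (fun t => q (i + t)) m R' where
  nonneg t ht := h.nonneg _ (by omega)
  generate t ht := h.generate _ (by omega)
  avoid t h0 h1 g e hg := h.avoid _ (by omega) (by omega) g e (hg.mono hR)

/-- Moving the base vertex to a neighbour costs one unit of radius. -/
theorem conj_syl (h : AvoidPath q n (R + 1)) (r : ℤ) (e : Bool) :
    AvoidPath (fun t => (syl r e)⁻¹ * q t * syl r e) n R where
  nonneg t ht := by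
    rw [expA_conj']
    exact h.nonneg t ht
  generate t ht := (h.generate t ht).conj _
  avoid t h0 h1 g f hg := by
    intro h2
    refine h.avoid t h0 h1 (syl r e * g) f (hg.syl_mul r e) ?_
    rw [mul_inv_rev, ← mul_assoc _ g⁻¹, mul_assoc (syl r e), mul_assoc (syl r e), ← h2]
    group

theorem exists_generate (h : AvoidPath q n R) (hn : 0 < n) {i : ℕ} (hi : i ≤ n) :
    ∃ q', Generate (q i) q' ∧ 0 ≤ expA q' := by
  rcases hi.lt_or_eq with h1 | rfl
  · exact ⟨_, h.generate i h1, h.nonneg _ h1⟩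
  · obtain ⟨i, rfl⟩ := Nat.exists_eq_add_of_le' hn
    exact ⟨_, (h.generate i (by omega)).symm, h.nonneg _ (by omega)⟩

theorem exists_through (h : AvoidPath q n R) {i : ℕ} (h0 : 0 < i) (h1 : i < n)
    (hq : q i ∈ aPos) : ∃ D, Through (q i) D := by
  refine _root_.exists_through hq ((h.nonneg i h1.le).lt_of_ne fun h2 => ?_)
  obtain ⟨q', hg, hq'⟩ := h.exists_generate (by omega) h1.le
  obtain ⟨g, e, he⟩ := hg.eq_conj_gb h2.symm hq'
  obtain ⟨j, hj, hje⟩ := signed_gb e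
  rw [he, hje] at hq
  obtain ⟨k, hk⟩ := dir_eq_none (dir_eq_none_of_mem_axis hj (g := g⁻¹) (by rwa [inv_inv]))
  rw [inv_eq_iff_eq_inv, ← zpow_neg] at hk
  -- An elliptic interior element fixing the base vertex is `b ^ (±1)`, which lies in every avoided
  -- ball.
  exact h.avoid i h0 h1 g e (hk ▸ .zpow R _) he

/-- Both pieces are shorter than `n`, so the radius `n - 1` suffices for the induction hypothesis on
each; the two bounds add. -/
theorem split (h : AvoidPath q n R) (hR : n ≤ R + 1)
    (ih : ∀ m < n, ∀ q D D', AvoidPath q m m → Through (q 0) D → Through (q m) D' →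
      ∀ e, |D e - D' e| ≤ 4 ^ m)
    {i : ℕ} (h0 : 0 < i) (h1 : i < n) (hq : q i ∈ aPos) {D D' : Bool → ℤ}
    (hD : Through (q 0) D) (hD' : Through (q n) D') (e : Bool) :
    |D e - D' e| ≤ 2 * 4 ^ (n - 1) := by
  obtain ⟨E, hE⟩ := h.exists_through h0 h1 hq
  have a1 := ih i h1 (fun t => q (0 + t)) D E (h.sub (by omega) (by omega)) hD
    (by simpa using hE) e
  have a2 := ih (n - i) (by omega) (fun t => q (i + t)) E D' (h.sub (by omega) (by omega)) hE
    (by simpa [Nat.add_sub_cancel' h1.le] using hD') e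
  have b1 : (4 : ℤ) ^ i ≤ 4 ^ (n - 1) := pow_le_pow_right₀ (by norm_num) (by omega)
  have b2 : (4 : ℤ) ^ (n - i) ≤ 4 ^ (n - 1) := pow_le_pow_right₀ (by norm_num) (by omega)
  have := abs_sub_le (D e) (E e) (D' e)
  omega

/-- Consecutive axes meet and each interior one lies in a single direction, so that direction
propagates along the path. -/
theorem exists_dir_eq (h : AvoidPath q n R) {g : F2} (hg : g⁻¹ * q 1 * g ∈ aPos)
    (hno : ∀ i, 0 < i → i < n → q i ∉ aPos) {m : ℕ} (hm : m + 1 < n) :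
    ∃ k, k⁻¹ * q (m + 1) * k ∈ aPos ∧ k⁻¹ * q (m + 2) * k ∈ aPos ∧ dir k = dir g := by
  have hq1 {i : ℕ} (hi : i < n) : q i ≠ 1 := (h.generate i hi).left_ne_one
  induction m with
  | zero =>
    obtain ⟨k, hk1, hk2⟩ := (h.generate 1 hm).exists_common (h.nonneg _ (by omega))
      (h.nonneg _ (by omega))
    exact ⟨k, hk1, hk2, dir_eq_of_axis (hq1 hm) (hno _ one_pos hm) hk1 hg⟩
  | succ m ih =>
    obtain ⟨k, -, hk2, hk⟩ := ih (by omega)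
    obtain ⟨l, hl1, hl2⟩ := (h.generate (m + 1 + 1) hm).exists_common (h.nonneg _ (by omega))
      (h.nonneg _ (by omega))
    exact ⟨l, hl1, hl2, (dir_eq_of_axis (hq1 hm) (hno _ (by omega) hm) hl1 hk2).trans hk⟩

theorem common_dir (h : AvoidPath q n R) (hn : 2 ≤ n) {D D' : Bool → ℤ}
    (hD : Through (q 0) D) (hD' : Through (q n) D')
    (hno : ∀ i, 0 < i → i < n → q i ∉ aPos) {g : F2} (hg0 : g⁻¹ * q 0 * g ∈ aPos)
    (hg : g⁻¹ * q 1 * g ∈ aPos) : ∃ e, dir g = some (D e, e) ∧ D e = D' e := by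
  have hne {i} (h0 : 0 < i) (h1 : i < n) {k : F2} (hk : k⁻¹ * q i * k ∈ aPos) :
      dir k ≠ none := by
    intro h
    obtain ⟨j, rfl⟩ := dir_eq_none h
    apply hno i h0 h1
    have := mul_mem (mul_mem (zpow_mem_aPos j) hk) (zpow_mem_aPos (-j))
    convert this using 1
    group
  obtain ⟨m, rfl⟩ := Nat.exists_eq_add_of_le' hn
  obtain ⟨k, hk1, hk2, hk⟩ := h.exists_dir_eq hg hno (m := m) (by omega)
  obtain ⟨e, he⟩ := hD.dir (hne one_pos (by omega) hg) hg0
  obtain ⟨f, hf⟩ := hD'.dir (hne (by omega) (by omega) hk1) hk2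
  rw [hk, he] at hf
  simp only [Option.some.injEq, Prod.mk.injEq] at hf
  obtain ⟨h1, rfl⟩ := hf
  exact ⟨e, he, h1⟩

/-- Both elements are hyperbolic and have turns in the same `{N, N + 1}`. A common vertex makes one
of their two directions agree: the forward one if it is the base vertex, the one leading to it
otherwise. The remaining directions then differ by at most one. -/
theorem bound_one (h : AvoidPath q 1 R) {D D' : Bool → ℤ} (hD : Through (q 0) D)
    (hD' : Through (q 1) D') (e : Bool) : |D e - D' e| ≤ 1 := by
  have hp := hD.expA_pos
  have hp' := hD'.expA_pos
  rcases (h.generate 0 one_pos).cases hp.le hp'.le with ⟨g, N, h2, h3⟩ | ⟨g, n, e, -, h2⟩ |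
    ⟨g, n, e, -, h2⟩
  · have key {q} (h : HasTurn N (g⁻¹ * q * g)) (hq : q ∈ aPos) : HasTurn N q := by
      have := h.conj (g := g⁻¹) (by convert hq using 1; group)
      convert this using 1
      group
    have t1 := (key (hasTurn_of_mem h2.1 h2.2) hD.1).turn hD
    have t2 := (key (hasTurn_of_mem h3.1 h3.2) hD'.1).turn hD'
    have hs : D true = D' true ∨ D false = D' false := by
      by_cases hg : dir g = none
      · obtain ⟨j, rfl⟩ := dir_eq_none hg
        have key' {q} {D : Bool → ℤ} (hD : Through q D)
            (h : (gb ^ j)⁻¹ * q * gb ^ j ∈ turnMonoid N ∧ 0 < expA ((gb ^ j)⁻¹ * q * gb ^ j)) :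
            D true = j := by
          have h4 := dir_of_mem_turnMonoid h.1 h.2
          rw [dir_mul_zpow, ← zpow_neg, dir_zpow_mul, ← signed_true q, hD.2 true] at h4
          simp only [Option.map_some, Option.some.injEq, Prod.mk.injEq, and_true] at h4
          omega
        exact .inl ((key' hD h2).trans (key' hD' h3).symm)
      · obtain ⟨e, he⟩ := hD.dir hg (turnMonoid_le N h2.1)
        obtain ⟨f, hf⟩ := hD'.dir hg (turnMonoid_le N h3.1)
        rw [he] at hf
        simp only [Option.some.injEq, Prod.mk.injEq] at hf
        obtain ⟨h1, rfl⟩ := hf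
        cases e
        · exact .inr h1
        · exact .inl h1
    cases e <;> rw [abs_le] <;> omega
  · rw [zero_add] at h2
    rw [h2, expA_conj, expA_signed_gb] at hp'
    exact absurd hp' (lt_irrefl _)
  · rw [h2, expA_conj, expA_signed_gb] at hp
    exact absurd hp (lt_irrefl _)

end AvoidPath

theorem abs_sub_le_four_pow (n : ℕ) : ∀ q D D', AvoidPath q n n → Through (q 0) D →
    Through (q n) D' → ∀ e, |D e - D' e| ≤ 4 ^ n := by
  induction n using Nat.strong_induction_on with
  | _ n ih =>
    intro q D D' h hD hD' x
    rcases Nat.lt_or_ge n 2 with hn | hn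
    · interval_cases n
      · have := (hD.2 x).symm.trans (hD'.2 x)
        simp only [Option.some.injEq, Prod.mk.injEq, and_true] at this
        simp [this]
      · exact (h.bound_one hD hD' x).trans (by norm_num)
    obtain ⟨m, rfl⟩ := Nat.exists_eq_add_of_le' (show 1 ≤ n by omega)
    have hpow : (4 : ℤ) ≤ 4 ^ m := by
      calc (4 : ℤ) = 4 ^ 1 := by norm_num
        _ ≤ 4 ^ m := pow_le_pow_right₀ (by norm_num) (by omega)
    have hpow' : (4 : ℤ) ^ (m + 1) = 4 * 4 ^ m := pow_succ' _ _
    by_cases hno : ∃ i, 0 < i ∧ i < m + 1 ∧ q i ∈ aPos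
    · obtain ⟨i, h0, h1, hi⟩ := hno
      have := h.split (by omega) ih h0 h1 hi hD hD' x
      rw [Nat.add_sub_cancel] at this
      omega
    push Not at hno
    obtain ⟨g, hg0, hg⟩ := (h.generate 0 (by omega)).exists_common (h.nonneg 0 (by omega))
      (h.nonneg 1 (by omega))
    obtain ⟨e, hge, hDe⟩ := h.common_dir hn hD hD' hno hg0 hg
    -- Recentre at the next vertex in the shared direction; there both axes have backward exponent
    -- zero, so the onward exponent is the turn up to sign.
    obtain ⟨E, hE, hE0⟩ := hD.conj_syl e
    obtain ⟨E', hE', hE0'⟩ := hD'.conj_syl e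
    rw [← hDe] at hE'
    obtain ⟨q', hq', hq0⟩ := h.exists_generate (by omega) (Nat.zero_le _)
    obtain ⟨N, hN⟩ := hq'.exists_hasTurn hD.expA_pos hq0 hD.1
    have t1 := hN.turn hD
    have t2 := (hN.conj_syl (hD.2 e)).turn hE
    obtain ⟨q', hq', hq0⟩ := h.exists_generate (by omega) le_rfl
    obtain ⟨N', hN'⟩ := hq'.exists_hasTurn hD'.expA_pos hq0 hD'.1
    have t3 := hN'.turn hD'
    have t4 := (hN'.conj_syl (by rw [hDe]; exact hD'.2 e)).turn hE'
    have h' := h.conj_syl (D e) e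
    have hEE : |E e - E' e| ≤ 2 * 4 ^ m := by
      by_cases hno' : ∃ i, 0 < i ∧ i < m + 1 ∧ (syl (D e) e)⁻¹ * q i * syl (D e) e ∈ aPos
      · obtain ⟨i, h0, h1, hi⟩ := hno'
        exact h'.split le_rfl ih h0 h1 hi hE hE' e
      · push Not at hno'
        obtain ⟨g', rfl, -⟩ := exists_eq_syl_mul hge
        obtain ⟨f, hf, hEf⟩ := h'.common_dir hn hE hE' hno' (g := g')
          (by convert hg0 using 1; group) (by convert hg using 1; group)
        have hne := dir_ne_of_dir_syl_mul hge
        obtain rfl : f = e := by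
          by_contra hfe
          obtain rfl : f = !e := by cases e <;> cases f <;> simp_all
          -- The shared direction cannot point back, because `g` lies beyond the edge just crossed.
          exact hne (by rw [hf, hE0])
        rw [hEf, sub_self, abs_zero]
        positivity
    -- Each end axis changes its turn by at most one between the two vertices, so the other
    -- exponents at the base vertex differ by at most `2 * 4 ^ m + 2 ≤ 4 ^ (m + 1)`.
    rw [abs_le] at hEE ⊢
    cases e <;> cases x <;> simp only [Bool.not_true, Bool.not_false] at hE0 hE0' <;> omega

/-! ### Generating pairs, bases and cyclic free factors. -/

/-- The endomorphism of `F2` that sends the generators to `p` and `q`. -/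
def pairHom (p q : F2) : F2 →* F2 := FreeGroup.lift ![p, q]

@[simp] theorem pairHom_ga (p q : F2) : pairHom p q ga = p := by simp [pairHom]
@[simp] theorem pairHom_gb (p q : F2) : pairHom p q gb = q := by simp [pairHom]

theorem F2_hom_ext {f g : F2 →* F2} (ha : f ga = g ga) (hb : f gb = g gb) : f = g := by
  ext i
  fin_cases i
  · exact ha
  · exact hb

theorem pairHom_comp (p q : F2) (f : F2 →* F2) :
    pairHom (f p) (f q) = f.comp (pairHom p q) := F2_hom_ext (by simp) (by simp)

theorem bijective_pairHom {p q p' q' : F2} (h1 : pairHom p q p' = ga) (h2 : pairHom p q q' = gb)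
    (h3 : pairHom p' q' p = ga) (h4 : pairHom p' q' q = gb) :
    Function.Bijective (pairHom p q) := by
  have e1 : (pairHom p q).comp (pairHom p' q') = MonoidHom.id F2 :=
    F2_hom_ext (by simpa using h1) (by simpa using h2)
  have e2 : (pairHom p' q').comp (pairHom p q) = MonoidHom.id F2 :=
    F2_hom_ext (by simpa using h3) (by simpa using h4)
  exact (MonoidHom.toMulEquiv _ _ e2 e1).bijective

/-- Transport of an elementary change of basis. -/
theorem bijective_pairHom_of {p q x y : F2} (h : Function.Bijective (pairHom p q))
    (hxy : Function.Bijective (pairHom x y)) :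
    Function.Bijective (pairHom (pairHom p q x) (pairHom p q y)) := by
  rw [pairHom_comp, MonoidHom.coe_comp]
  exact h.comp hxy

theorem PosPair.bijective {N : ℤ} {X Y : F2} (h : PosPair N X Y) :
    Function.Bijective (pairHom X Y) := by
  have hl : Function.Bijective (pairHom (ga * gb) gb) :=
    bijective_pairHom (p' := ga * gb⁻¹) (q' := gb) (by simp) (by simp) (by simp) (by simp)
  have hr : Function.Bijective (pairHom ga (ga * gb)) :=
    bijective_pairHom (p' := ga) (q' := ga⁻¹ * gb) (by simp) (by simp) (by simp) (by simp)
  induction h with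
  | base =>
    have hN : Function.Bijective (pairHom (ga * gb ^ N) gb) :=
      bijective_pairHom (p' := ga * gb ^ (-N)) (q' := gb) (by simp) (by simp) (by simp) (by simp)
    have := bijective_pairHom_of hN hr
    simpa [mul_assoc, ← zpow_add_one] using this
  | left h ih => simpa using bijective_pairHom_of ih hl
  | right h ih => simpa using bijective_pairHom_of ih hr

theorem StdPair.bijective {X Y : F2} (h : StdPair X Y) : Function.Bijective (pairHom X Y) := by
  rcases h with ⟨n, rfl, rfl⟩ | ⟨N, h⟩
  · exact bijective_pairHom (p' := ga * gb ^ (-n)) (q' := gb) (by simp) (by simp) (by simp)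
      (by simp)
  · exact h.bijective

/-- `F2` is Hopfian: a generating pair is a basis. -/
theorem Generate.bijective {x y : F2} (h : Generate x y) : Function.Bijective (pairHom x y) := by
  have hswap : Function.Bijective (pairHom gb ga) :=
    bijective_pairHom (p' := gb) (q' := ga) (by simp) (by simp) (by simp) (by simp)
  have hsigned (e f : Bool) : Function.Bijective (pairHom (signed ga e) (signed gb f)) :=
    bijective_pairHom (p' := signed ga e) (q' := signed gb f)
      (by cases e <;> simp) (by cases f <;> simp) (by cases e <;> simp) (by cases f <;> simp)
  obtain ⟨g, X, Y, e, f, hs, h⟩ := h.isStandard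
  have key : Function.Bijective (pairHom (g * signed X e * g⁻¹) (g * signed Y f * g⁻¹)) := by
    have h1 := bijective_pairHom_of hs.bijective (hsigned e f)
    have h2 : pairHom X Y (signed ga e) = signed X e := by cases e <;> simp
    have h3 : pairHom X Y (signed gb f) = signed Y f := by cases f <;> simp
    rw [h2, h3] at h1
    have h4 := pairHom_comp (signed X e) (signed Y f) (MulAut.conj g).toMonoidHom
    simp only [MulEquiv.toMonoidHom_eq_coe, MonoidHom.coe_coe, MulAut.conj_apply] at h4
    rw [h4, MonoidHom.coe_comp]
    exact (MulAut.conj g).bijective.comp h1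
  rcases h with ⟨rfl, rfl⟩ | ⟨rfl, rfl⟩
  · exact key
  · simpa using bijective_pairHom_of key hswap

theorem Generate.isBasisPair {x y : F2} (h : Generate x y) : IsBasisPair x y := by
  refine ⟨.ofRepr (MulEquiv.ofBijective _ h.bijective).symm, ?_, ?_⟩
  · exact pairHom_ga x y
  · exact pairHom_gb x y

theorem Generate.isFreeProduct {p q : F2} (h : Generate p q) :
    IsFreeProduct (Subgroup.zpowers p) (Subgroup.zpowers q) := by
  let P : Subgroup.zpowers p := ⟨p, Subgroup.mem_zpowers p⟩
  let Q : Subgroup.zpowers q := ⟨q, Subgroup.mem_zpowers q⟩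
  let E : F2 →* Monoid.Coprod (Subgroup.zpowers p) (Subgroup.zpowers q) :=
    FreeGroup.lift ![Monoid.Coprod.inl P, Monoid.Coprod.inr Q]
  let L : Monoid.Coprod (Subgroup.zpowers p) (Subgroup.zpowers q) →* F2 :=
    Monoid.Coprod.lift (Subgroup.zpowers p).subtype (Subgroup.zpowers q).subtype
  have ea : E ga = Monoid.Coprod.inl P := by simp [E]
  have eb : E gb = Monoid.Coprod.inr Q := by simp [E]
  have hcomp : L.comp E = pairHom p q :=
    F2_hom_ext (by simp [L, ea, P]) (by simp [L, eb, Q])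
  have hE : Function.Surjective E := by
    rw [← MonoidHom.range_eq_top, eq_top_iff, ← Monoid.Coprod.range_inl_sup_range_inr, sup_le_iff]
    constructor
    · rintro _ ⟨⟨_, n, rfl⟩, rfl⟩
      refine ⟨ga ^ n, ?_⟩
      rw [map_zpow, ea, ← map_zpow]
      rfl
    · rintro _ ⟨⟨_, n, rfl⟩, rfl⟩
      refine ⟨gb ^ n, ?_⟩
      rw [map_zpow, eb, ← map_zpow]
      rfl
  have hb := h.bijective
  rw [← hcomp, MonoidHom.coe_comp] at hb
  exact ⟨(Function.Injective.of_comp_iff' L ⟨hb.1.of_comp, hE⟩).1 hb.1, hb.2.of_comp⟩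

theorem Generate.not_mem_zpowers {p q : F2} (h : Generate p q) : q ∉ Subgroup.zpowers p := by
  intro hq
  have : Generate p p := h.of_mem (fst_mem_closure _ _) (by
    rwa [Set.pair_eq_singleton, ← Subgroup.zpowers_eq_closure])
  exact this.fst_ne_snd rfl

theorem Generate.exists_vertex {p q : F2} (h : Generate p q) :
    ∃ x : FreeFactorVertex, x.1 = Subgroup.zpowers p := by
  refine ⟨⟨Subgroup.zpowers p, ⟨_, h.isFreeProduct⟩, ?_, ?_⟩, rfl⟩
  · rw [Ne, Subgroup.zpowers_eq_bot]
    exact h.left_ne_one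
  · intro h1
    exact h.not_mem_zpowers (by rw [h1]; trivial)

theorem Generate.adj {p q : F2} (h : Generate p q) {x y : FreeFactorVertex}
    (hx : x.1 = Subgroup.zpowers p) (hy : y.1 = Subgroup.zpowers q) : AF2.Adj x y := by
  refine ⟨?_, by rw [hx, hy]; exact h.isFreeProduct⟩
  rintro rfl
  exact h.not_mem_zpowers (by rw [← hx, hy]; exact Subgroup.mem_zpowers q)

theorem generate_of_adj {p q : F2} {x y : FreeFactorVertex} (h : AF2.Adj x y)
    (hx : x.1 = Subgroup.zpowers p) (hy : y.1 = Subgroup.zpowers q) : Generate p q := by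
  have h1 := h.2
  rw [hx, hy] at h1
  have h2 := MonoidHom.range_eq_top.2 h1.2
  rw [Monoid.Coprod.range_lift, Subgroup.range_subtype, Subgroup.range_subtype,
    Subgroup.zpowers_eq_closure, Subgroup.zpowers_eq_closure, ← Subgroup.closure_union] at h2
  exact h2

/-- A free group is cyclic if it has exactly two homomorphisms to the group of order two. -/
theorem exists_zpowers_eq_of_card {H : Subgroup F2}
    (h : Nat.card (H →* Multiplicative (ZMod 2)) = 2) : ∃ p, H = Subgroup.zpowers p := by
  have h1 := Nat.card_congr (IsFreeGroup.lift (G := H) (H := Multiplicative (ZMod 2)))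
  rw [h] at h1
  have hfin : Finite (IsFreeGroup.Generators H → Multiplicative (ZMod 2)) :=
    Nat.finite_of_card_ne_zero (by omega)
  classical
  have hgen : Finite (IsFreeGroup.Generators H) :=
    Finite.of_injective (fun i j => if i = j then Multiplicative.ofAdd (1 : ZMod 2) else 1) <| by
      intro i j hij
      by_contra hne
      have := congrFun hij i
      simp only [if_true, if_neg (Ne.symm hne)] at this
      exact absurd this (by decide)
  have h2 : Nat.card (Multiplicative (ZMod 2)) = 2 := by simp
  rw [Nat.card_fun, h2] at h1
  have h3 : Nat.card (IsFreeGroup.Generators H) = 1 :=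
    Nat.pow_right_injective le_rfl (by simpa using h1)
  obtain ⟨hsub, ⟨i⟩⟩ := Nat.card_eq_one_iff_unique.1 h3
  refine ⟨(IsFreeGroup.of i : H), le_antisymm ?_ ?_⟩
  · intro g hg
    have h4 : ∀ w : FreeGroup (IsFreeGroup.Generators H), w ∈ Subgroup.zpowers (of i) := by
      intro w
      rw [Subgroup.zpowers_eq_closure]
      have h5 : ({of i} : Set (FreeGroup (IsFreeGroup.Generators H))) = Set.range of := by
        ext v
        simp only [Set.mem_singleton_iff, Set.mem_range]
        exact ⟨fun h => ⟨i, h.symm⟩, fun ⟨j, hj⟩ => by rw [← hj, Subsingleton.elim j i]⟩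
      rw [h5, FreeGroup.closure_range_of]
      trivial
    obtain ⟨n, hn⟩ := h4 ((IsFreeGroup.toFreeGroup H) ⟨g, hg⟩)
    refine ⟨n, ?_⟩
    have h6 : (IsFreeGroup.of i : H) ^ n = ⟨g, hg⟩ := by
      apply (IsFreeGroup.toFreeGroup H).injective
      rw [map_zpow, ← hn]
      congr 1
      exact (IsFreeGroup.toFreeGroup H).apply_symm_apply _
    simpa using congrArg Subtype.val h6
  · rw [Subgroup.zpowers_le]
    exact (IsFreeGroup.of i : H).2

theorem two_le_card_hom {H : Subgroup F2} (h : H ≠ ⊥)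
    [Finite (H →* Multiplicative (ZMod 2))] :
    2 ≤ Nat.card (H →* Multiplicative (ZMod 2)) := by
  have hne : Nonempty (IsFreeGroup.Generators H) := by
    by_contra h1
    rw [not_nonempty_iff] at h1
    apply h
    rw [eq_bot_iff]
    intro g hg
    have := (IsFreeGroup.toFreeGroup H).injective
      (Subsingleton.elim (IsFreeGroup.toFreeGroup H ⟨g, hg⟩) (IsFreeGroup.toFreeGroup H 1))
    simpa using congrArg Subtype.val this
  obtain ⟨i⟩ := hne
  have : Nontrivial (H →* Multiplicative (ZMod 2)) := by
    refine ⟨IsFreeGroup.lift 1, IsFreeGroup.lift fun _ => Multiplicative.ofAdd 1, fun h => ?_⟩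
    have : (1 : Multiplicative (ZMod 2)) = Multiplicative.ofAdd 1 :=
      congrFun (IsFreeGroup.lift.injective h) i
    exact absurd this (by decide)
  exact Finite.one_lt_card

/-- Homomorphisms to the group of order two multiply over a free product, and `F2` has four. Both
factors are free and nontrivial, so each has at least two; hence each has exactly two, and rank one.
-/
theorem exists_generator (x : FreeFactorVertex) : ∃ p, x.1 = Subgroup.zpowers p := by
  obtain ⟨H, ⟨K, hK⟩, hbot, htop⟩ := x
  have hKbot : K ≠ ⊥ := by
    rintro rfl
    have h2 := MonoidHom.range_eq_top.2 hK.2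
    rw [Monoid.Coprod.range_lift, Subgroup.range_subtype, Subgroup.range_subtype, sup_bot_eq] at h2
    exact htop h2
  have h1 := Nat.card_congr (Monoid.Coprod.liftEquiv (M := H) (N := K)
    (P := Multiplicative (ZMod 2)))
  have h2 := Nat.card_congr ((MulEquiv.ofBijective _ hK).monoidHomCongrLeftEquiv
    (N := Multiplicative (ZMod 2)))
  have h3 := Nat.card_congr (FreeGroup.lift (α := Fin 2) (β := Multiplicative (ZMod 2)))
  have h4 : Nat.card (Fin 2 → Multiplicative (ZMod 2)) = 4 := by simp
  rw [Nat.card_prod, h2, ← h3, h4] at h1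
  have f1 : Finite (H →* Multiplicative (ZMod 2)) :=
    Nat.finite_of_card_ne_zero fun h => by simp [h] at h1
  have f2 : Finite (K →* Multiplicative (ZMod 2)) :=
    Nat.finite_of_card_ne_zero fun h => by simp [h] at h1
  have g1 := two_le_card_hom hbot
  have g2 := two_le_card_hom hKbot
  exact exists_zpowers_eq_of_card (by nlinarith)

/-! ### From the tree back to the free factor complex. -/

theorem zpowers_signed (g : F2) (e : Bool) :
    Subgroup.zpowers (signed g e) = Subgroup.zpowers g := by
  cases e <;> simp

theorem generate_ga_gb : Generate ga gb := by
  rw [Generate, ← FreeGroup.closure_range_of]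
  congr 1
  ext g
  simp [Fin.exists_fin_two, eq_comm]

theorem Generate.map_equiv {x y : F2} (h : Generate x y) (φ : F2 ≃* F2) :
    Generate (φ x) (φ y) := h.map φ.toMonoidHom φ.surjective

theorem Generate.zpow_mul_zpow {x y : F2} (h : Generate x y) (i j : ℤ) :
    Generate (y ^ i * x * y ^ j) y := by
  have hy := snd_mem_closure (y ^ i * x * y ^ j) y
  refine h.of_mem ?_ hy
  have := mul_mem (mul_mem (zpow_mem hy (-i)) (fst_mem_closure (y ^ i * x * y ^ j) y))
    (zpow_mem hy (-j))
  convert this using 1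
  group

theorem mem_kExt_right (n : ℕ) (x b : FreeFactorVertex) : b ∈ kExt n x b := by
  induction n with
  | zero => simp [kExt]
  | succ n ih => exact .inl ih

/-- The neighbours of `b` at bounded twist from `x` lie in a bounded extension of `{x, b}`. -/
theorem mem_kExt {φ : F2 ≃* F2} {x b : FreeFactorVertex} (hx : x.1 = Subgroup.zpowers (φ ga))
    (hb : b.1 = Subgroup.zpowers (φ gb)) (n : ℕ) : ∀ (i j : ℤ), |i| + |j| ≤ n →
    ∀ y : FreeFactorVertex, y.1 = Subgroup.zpowers (φ (gb ^ i * ga * gb ^ j)) → y ∈ kExt n x b := by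
  have hgen (i j : ℤ) := generate_ga_gb.zpow_mul_zpow i j
  induction n with
  | zero =>
    intro i j hij y hy
    obtain ⟨rfl, rfl⟩ : i = 0 ∧ j = 0 := by
      constructor <;> rw [← abs_eq_zero] <;> have := abs_nonneg i <;> have := abs_nonneg j <;>
        push_cast at hij <;> omega
    left
    apply Subtype.ext
    rw [hy, hx]
    simp
  | succ n ih =>
    intro i j hij y hy
    by_cases hn : |i| + |j| ≤ n
    · exact .inl (ih i j hn y hy)
    -- Moving one exponent a unit towards zero gives a neighbour of the new vertex that is also
    -- adjacent to `b`, so the new vertex is a stick on an earlier edge.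
    · have key : ∃ i' j' : ℤ, |i'| + |j'| ≤ n ∧
          Generate (gb ^ i * ga * gb ^ j) (gb ^ i' * ga * gb ^ j') := by
        have hi := abs_cases i
        have hj := abs_cases j
        have hi1 := abs_cases (i - 1)
        have hi2 := abs_cases (i + 1)
        have hj1 := abs_cases (j - 1)
        have hj2 := abs_cases (j + 1)
        push_cast at hij
        rcases lt_trichotomy i 0 with h | h | h
        · refine ⟨i + 1, j, by omega, ?_⟩
          convert (hgen (i + 1) j).symm.inv_left.mul_left using 1
          group
        · rcases le_total j 0 with h' | h'
          · refine ⟨i, j + 1, by omega, ?_⟩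
            convert (hgen i (j + 1)).inv_right.mul_right.symm using 1
            group
          · refine ⟨i, j - 1, by omega, ?_⟩
            convert (hgen i (j - 1)).mul_right.symm using 1
            group
        · refine ⟨i - 1, j, by omega, ?_⟩
          convert (hgen (i - 1) j).symm.mul_left using 1
          group
      obtain ⟨i', j', h1, h2⟩ := key
      obtain ⟨z, hz⟩ := ((hgen i' j').map_equiv φ).exists_vertex
      exact .inr ⟨z, ih i' j' h1 z hz, b, mem_kExt_right n x b,
        ((hgen i' j').map_equiv φ).adj hz hb, (h2.map_equiv φ).adj hy hz,
        ((hgen i j).map_equiv φ).adj hy hb⟩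

/-- Each syllable contributes one `1`-conjugation: `b` and its conjugate by a syllable are
`1`-conjugate, and the remaining syllables are handled after absorbing this conjugation into `φ`. -/
theorem exists_conjWalk {n : ℕ} {g : F2} (hg : InBall n g) :
    ∀ (φ : F2 ≃* F2) (b x : FreeFactorVertex), b.1 = Subgroup.zpowers (φ gb) →
      x.1 = Subgroup.zpowers (φ (g * gb * g⁻¹)) → ∃ p : conjGraph.Walk x b, p.length ≤ n := by
  induction hg with
  | zpow n j =>
    intro φ b x hb hx
    obtain rfl : x = b := by
      apply Subtype.ext
      rw [hx, hb]
      congr 2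
      group
    exact ⟨.nil, by simp⟩
  | @syl_mul n g r e hg ih =>
    intro φ b x hb hx
    let ψ := (MulAut.conj (syl r e)).trans φ
    have hψ (w : F2) : ψ w = φ (syl r e * w * (syl r e)⁻¹) := rfl
    obtain ⟨c, hc⟩ := (generate_ga_gb.symm.map_equiv ψ).exists_vertex
    obtain ⟨p, hp⟩ := ih ψ c x hc (by
      rw [hx, hψ]
      congr 2
      group)
    have hbc : conjGraph.Adj b c := by
      refine ⟨φ gb, φ (syl r e)⁻¹, Generate.isBasisPair ?_, hb, ?_⟩
      · refine Generate.map_equiv ?_ φ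
        have h1 : Generate (aPow (!e)) gb := by
          cases e
          · exact generate_ga_gb
          · exact generate_ga_gb.inv_left
        convert (h1.zpow_mul_zpow 0 (-r)).symm using 1
        simp [syl]
      · rw [hc, hψ]
        congr 1
        simp
    exact ⟨p.append (.cons hbc.symm .nil), by simpa using hp⟩

theorem exists_mem_conjSphere {x b : FreeFactorVertex} {n : ℕ} (p : conjGraph.Walk x b)
    (hp : p.length ≤ n) : ∃ j ≤ n, x ∈ conjSphere j b := by
  classical
  have hex : ∃ m, ∃ p : conjGraph.Walk b x, p.IsPath ∧ p.length = m :=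
    ⟨_, p.reverse.bypass, p.reverse.bypass_isPath, rfl⟩
  refine ⟨Nat.find hex, ?_, Nat.find_spec hex, fun m hm => Nat.find_min' hex hm⟩
  refine (Nat.find_min' hex ⟨p.reverse.bypass, p.reverse.bypass_isPath, rfl⟩).trans ?_
  refine p.reverse.length_bypass_le_length.trans ?_
  rwa [SimpleGraph.Walk.length_reverse]

theorem adj_of_mem_sphereD_one {x b : FreeFactorVertex} (h : x ∈ sphereD 1 b) : AF2.Adj b x := by
  obtain ⟨p, hp⟩ := h.1
  exact SimpleGraph.Walk.adj_of_length_eq_one hp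

/-- In the standard form `b` is itself the elliptic member, and since it fixes only the base vertex
the conjugator is a power of `b`. -/
theorem Generate.eq_zpow_mul_zpow {q : F2} (h : Generate q gb) (h0 : 0 ≤ expA q) :
    ∃ i j : ℤ, q = gb ^ i * ga * gb ^ j := by
  rcases h.cases h0 (by simp) with ⟨g, N, -, h2⟩ | ⟨g, n, e, rfl, h2⟩ | ⟨g, n, e, h2, -⟩
  · rw [expA_conj'] at h2
    simp at h2
  · have h3 : g⁻¹ * gb ^ (1 : ℤ) * g ∈ aPos := by
      obtain ⟨j, -, hj⟩ := signed_gb e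
      rw [hj] at h2
      rw [zpow_one]
      nth_rewrite 1 [h2]
      rw [conj_inv_conj]
      exact zpow_mem_aPos j
    obtain ⟨m, rfl⟩ := dir_eq_none (dir_eq_none_of_mem_axis one_ne_zero h3)
    exact ⟨m, n - m, by group⟩
  · have := congrArg expA h2
    rw [expA_conj] at this
    simp at this

theorem through_zpow_mul_zpow (i j : ℤ) :
    Through (gb ^ i * ga * gb ^ j) fun e => if e then i else -j := by
  refine ⟨mul_mem (mul_mem (zpow_mem_aPos i) ga_mem_aPos) (zpow_mem_aPos j), fun e => ?_⟩
  cases e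
  · have h : (gb ^ i * ga * gb ^ j)⁻¹ = syl (-j) false * gb ^ (-i) := by simp [syl, mul_assoc]
    rw [signed_false, h, dir_syl_mul (by rw [dir_zpow]; simp)]
    simp
  · have h : gb ^ i * ga * gb ^ j = syl i true * gb ^ j := rfl
    rw [signed_true, h, dir_syl_mul (by rw [dir_zpow]; simp)]
    simp

theorem mainTheorem9 :
    ∀ k : ℕ, ∃ k' : ℕ, ∀ b x y : FreeFactorVertex,
      x ∈ sphereD 1 b → y ∈ sphereD 1 b →
      (∃ p : AF2.Walk x y, p.length ≤ k ∧ AvoidsConj p k b) →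
      y ∈ kExt k' x b := by
  intro k
  -- The bound `4 ^ k` applies to each of the two exponents `i` and `j`.
  refine ⟨2 * 4 ^ k, ?_⟩
  rintro b x y hx hy ⟨p, hpk, hp⟩
  obtain ⟨v, hv⟩ := exists_generator x
  obtain ⟨w, hw⟩ := exists_generator b
  have hgen := generate_of_adj (adj_of_mem_sphereD_one hx).symm hv hw
  let φ : F2 ≃* F2 := MulEquiv.ofBijective _ hgen.bijective
  have hφa : φ ga = v := pairHom_ga v w
  have hφb : φ gb = w := pairHom_gb v w
  rw [← hφa] at hv
  rw [← hφb] at hw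
  -- Choose generators with nonnegative `a`-exponent; at the start take `a` itself, so that both
  -- initial exponents are zero.
  have hlift (i : ℕ) : ∃ q, (p.getVert i).1 = Subgroup.zpowers (φ q) ∧ 0 ≤ expA q ∧
      (i = 0 → q = ga) := by
    rcases Nat.eq_zero_or_pos i with rfl | hi
    · exact ⟨ga, by rw [SimpleGraph.Walk.getVert_zero, hv], by simp, fun _ => rfl⟩
    · obtain ⟨q, hq⟩ := exists_generator (p.getVert i)
      rcases le_total 0 (expA (φ.symm q)) with h | h
      · exact ⟨φ.symm q, by simpa using hq, h, by omega⟩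
      · exact ⟨(φ.symm q)⁻¹, by simpa using hq, by simpa using h, by omega⟩
  choose q hq hq0 hqa using hlift
  have hpath : AvoidPath q p.length p.length := by
    refine ⟨fun i _ => hq0 i, fun i hi => ?_, fun i h0 h1 g e hg he => ?_⟩
    · have := (generate_of_adj (p.adj_getVert_succ hi) (hq i) (hq (i + 1))).map_equiv φ.symm
      simpa using this
    · refine hp i h0 h1 ?_
      have h2 : (p.getVert i).1 = Subgroup.zpowers (φ (g * gb * g⁻¹)) := by
        rw [hq, he, ← zpowers_signed (φ (g * gb * g⁻¹)) e]
        cases e <;> simp [mul_assoc]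
      obtain ⟨c, hc⟩ := exists_conjWalk hg φ b _ hw h2
      obtain ⟨j, hj, hj'⟩ := exists_mem_conjSphere c (hc.trans hpk)
      exact Set.mem_iUnion₂.2 ⟨j, hj, hj'⟩
  have hyq : y.1 = Subgroup.zpowers (φ (q p.length)) := by
    rw [← hq, SimpleGraph.Walk.getVert_length]
  have hgy : Generate (q p.length) gb := by
    simpa using (generate_of_adj (adj_of_mem_sphereD_one hy).symm hyq hw).map_equiv φ.symm
  obtain ⟨i, j, hij⟩ := hgy.eq_zpow_mul_zpow (hq0 _)
  have hthrough := through_zpow_mul_zpow i j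
  rw [← hij] at hthrough
  have hstart := through_zpow_mul_zpow 0 0
  rw [zpow_zero, one_mul, mul_one, ← hqa 0 rfl] at hstart
  have hbound := abs_sub_le_four_pow _ q _ _ hpath hstart hthrough
  have h1 := hbound true
  have h2 := hbound false
  have h3 : (4 : ℤ) ^ p.length ≤ 4 ^ k := pow_le_pow_right₀ (by norm_num) hpk
  simp only [if_true, zero_sub, abs_neg, neg_zero, Bool.false_eq_true, if_false, neg_neg] at h1 h2
  refine mem_kExt hv hw _ i j ?_ y (by rw [hyq, hij])
  push_cast
  omega
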